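/- For $\delta\in\mathbb R$ let $\Omega_\delta=\{s\in\mathbb C:\operatorname{Re}s>\delta\}$. Let $\mu$ be a Borel probability measure on $[0,\infty)$ with $0$ in its support, and put $w_n=\int_{[0,\infty)} n^{-2\sigma}\,d\mu(\sigma)$ for $n=1,2,\dots$. Let $\mathcal H^{\mathbf w}$ be the Hilbert space of Dirichlet series $\sum_{n\ge1}a_nn^{-s}$ with $\sum_{n\ge1}|a_n|^2w_n<\infty$ and inner product $\langle\sum a_nn^{-s},\sum b_nn^{-s}\rangle_{\mathbf w}=\sum_{n\ge1} a_n\overline{b_n}w_n$. Call a real number $\sigma_0>0$ admissible if $\sum_{n\ge1} w_n^{-1}n^{-2\sigma}<\infty$ for every $\sigma>\sigma_0$; in that case each $f\in\mathcal H^{\mathbf w}$ converges absolutely in $\Omega_{\sigma_0}$. A multiplier of $\mathcal H^{\mathbf w}$ is a function $\varphi$ on $\Omega_{\sigma_0}$ such that $\varphi f\in\mathcal H^{\mathbf w}$ for every $f\in\mathcal H^{\mathbf w}$, and $M_\varphi f=\varphi f$. Let $H^\infty(\Omega_0)\cap\mathcal D$ be the algebra of bounded analytic functions on $\Omega_0$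 that are represented by a convergent Dirichlet series in some right half-plane, with the norm $|\varphi|_{\Omega_0}=\sup_{s\in\Omega_0}|\varphi(s)|$. Theorem (McCarthy). The number $\sigma_0=1/2$ is admissible. For every admissible $\sigma_0$, each multiplier $\varphi$ of $\mathcal H^{\mathbf w}$ defines a bounded operator $M_\varphi$ on $\mathcal H^{\mathbf w}$, and the multiplier algebra $\mathfrak M=\{M_\varphi:\varphi\text{ a multiplier}\}$, with the operator norm, is isometrically isomorphic, as a complex algebra, to $H^\infty(\Omega_0)\cap\mathcal D$. The isomorphism sends an operator in $\mathfrak M$ to a function $\psi\in H^\infty(\Omega_0)\cap\mathcal D$ such that the operator is multiplication by $\psi$ on $\Omega_{\sigma_0}$; in particular $\|M_\varphi\|=|\psi|_{\Omega_0}$, where $\psi$ is the extension of $\varphi$ to $\Omega_0$. -/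

import Mathlib

open Filter Topology MeasureTheory
open scoped NNReal ENNReal BoundedContinuousFunction ComplexConjugate

noncomputable section

namespace DirichletMult

/-- The open right half-plane `Ω_δ`. -/
def Omega (δ : ℝ) : Set ℂ := {s : ℂ | δ < s.re}

/-- The `n`-th term `a_n n^{-s}` of a Dirichlet series (indexed by `n = 1, 2, …`). -/
def dterm (a : ℕ+ → ℂ) (s : ℂ) (n : ℕ+) : ℂ := a n * ((n : ℕ) : ℂ) ^ (-s)

/-- The (possibly only conditionally convergent) Dirichlet series `∑_{n ≥ 1} a_n n^{-s}`
converges at `s`, with sum `z`: its partial sums `∑_{n=1}^N a_n n^{-s}` tend to `z`. -/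
def HasDirichletSum (a : ℕ+ → ℂ) (s z : ℂ) : Prop :=
  Tendsto (fun N : ℕ => ∑ n ∈ Finset.range N, dterm a s n.succPNat) atTop (𝓝 z)

/-! ### The Hilbert space of Dirichlet series with weight `w` -/

/-- A sequence `w_1, w_2, …` of positive real numbers. -/
abbrev Weight : Type := ℕ+ → {r : ℝ // 0 < r}

theorem summable_weighted_iff (w : Weight) (a : ℕ+ → ℂ) :
    (Summable fun n => ‖a n‖ ^ 2 * (w n : ℝ)) ↔
      Memℓp (fun n => ((√(w n : ℝ) : ℝ) : ℂ) * a n) 2 := by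
  rw [memℓp_gen_iff (by norm_num)]
  refine summable_congr fun n => ?_
  have h := Real.sq_sqrt (w n).2.le
  simp only [ENNReal.toReal_ofNat, Real.rpow_two, norm_mul, Complex.norm_real, mul_pow,
    Real.norm_eq_abs, sq_abs, h]
  ring

/-- The space `H^w` of Dirichlet series `∑ a_n n^{-s}` with `∑ |a_n|² w_n < ∞`; an element is
given by its coefficients. -/
def HSub (w : Weight) : Submodule ℂ (ℕ+ → ℂ) where
  carrier := {a | Summable fun n => ‖a n‖ ^ 2 * (w n : ℝ)}
  zero_mem' := by simp
  add_mem' := by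
    intro a b ha hb
    rw [Set.mem_ofPred_eq, summable_weighted_iff] at *
    convert ha.add hb using 1
    ext n
    simp [mul_add]
  smul_mem' := by
    intro c a ha
    rw [Set.mem_ofPred_eq, summable_weighted_iff] at *
    convert ha.const_smul c using 1
    ext n
    simp [mul_left_comm]

/-- The space `H^w`, as a type. -/
def H (w : Weight) : Type := HSub w

instance (w : Weight) : AddCommGroup (H w) := inferInstanceAs (AddCommGroup (HSub w))

instance (w : Weight) : Module ℂ (H w) := inferInstanceAs (Module ℂ (HSub w))

/-- The coefficients `a_n` of an element of `H^w`. -/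
def H.coeff {w : Weight} (f : H w) : ℕ+ → ℂ := f.1

theorem H.summable {w : Weight} (f : H w) : Summable fun n => ‖f.coeff n‖ ^ 2 * (w n : ℝ) := f.2

@[simp] theorem H.coeff_add {w : Weight} (f g : H w) (n : ℕ+) :
    (f + g).coeff n = f.coeff n + g.coeff n := rfl

@[simp] theorem H.coeff_smul {w : Weight} (c : ℂ) (f : H w) (n : ℕ+) :
    (c • f).coeff n = c * f.coeff n := rfl

@[ext] theorem H.ext {w : Weight} {f g : H w} (h : ∀ n, f.coeff n = g.coeff n) : f = g :=
  Subtype.ext (funext h)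

theorem H.summable_inner {w : Weight} (f g : H w) :
    Summable fun n => g.coeff n * conj (f.coeff n) * ((w n : ℝ) : ℂ) := by
  refine Summable.of_norm_bounded (f.summable.add g.summable) fun n => ?_
  have hw := (w n).2
  simp only [norm_mul, RCLike.norm_conj, Complex.norm_real, Real.norm_eq_abs, abs_of_pos hw]
  nlinarith [mul_nonneg hw.le (sq_nonneg (‖f.coeff n‖ - ‖g.coeff n‖)),
    mul_nonneg hw.le (sq_nonneg (‖f.coeff n‖)), mul_nonneg hw.le (sq_nonneg (‖g.coeff n‖))]

theorem inner_self_term {w : Weight} (f : H w) (n : ℕ+) :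
    f.coeff n * conj (f.coeff n) * ((w n : ℝ) : ℂ) = ((‖f.coeff n‖ ^ 2 * (w n : ℝ) : ℝ) : ℂ) := by
  rw [Complex.mul_conj, Complex.normSq_eq_norm_sq]
  push_cast
  ring

/-- The inner product `⟨∑ a_n n^{-s}, ∑ b_n n^{-s}⟩ = ∑ a_n conj(b_n) w_n` of `H^w`
(conjugate-linear in the first argument of `inner`, as is the convention in Mathlib). -/
@[reducible]
def innerCore (w : Weight) : InnerProductSpace.Core ℂ (H w) where
  inner f g := ∑' n, g.coeff n * conj (f.coeff n) * ((w n : ℝ) : ℂ)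
  conj_inner_symm f g := by
    rw [Complex.conj_tsum]
    refine tsum_congr fun n => ?_
    simp only [map_mul, Complex.conj_conj, Complex.conj_ofReal]
    ring
  re_inner_nonneg f := by
    simp only [inner_self_term, ← Complex.ofReal_tsum]
    exact tsum_nonneg fun n => mul_nonneg (sq_nonneg _) (w n).2.le
  add_left f g h := by
    rw [← (f.summable_inner h).tsum_add (g.summable_inner h)]
    refine tsum_congr fun n => ?_
    simp only [H.coeff_add, map_add]
    ring
  smul_left f g c := by
    rw [← tsum_mul_left]
    refine tsum_congr fun n => ?_
    simp only [H.coeff_smul, map_mul]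
    ring
  definite f hf := by
    simp only [inner_self_term, ← Complex.ofReal_tsum, Complex.ofReal_eq_zero] at hf
    have h0 := (f.summable.hasSum_iff.2 hf)
    rw [hasSum_zero_iff_of_nonneg fun n => mul_nonneg (sq_nonneg _) (w n).2.le] at h0
    ext n
    have := congrFun h0 n
    have h2 : f.coeff n = 0 := by simpa [(w n).2.ne'] using this
    exact h2

instance (w : Weight) : NormedAddCommGroup (H w) := (innerCore w).toNormedAddCommGroup

instance (w : Weight) : InnerProductSpace ℂ (H w) := InnerProductSpace.ofCore (innerCore w).toCore

theorem H.norm_sq_eq {w : Weight} (f : H w) : ‖f‖ ^ 2 = ∑' n, ‖f.coeff n‖ ^ 2 * (w n : ℝ) := by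
  have h : inner ℂ f f = ∑' n, f.coeff n * conj (f.coeff n) * ((w n : ℝ) : ℂ) := rfl
  simp only [inner_self_term, ← Complex.ofReal_tsum] at h
  rw [inner_self_eq_norm_sq_to_K] at h
  exact Complex.ofReal_injective (by rw [← h]; push_cast; rfl)

/-- The isometric identification `(a_n) ↦ (w_n^{1/2} a_n)` of `H^w` with `ℓ²`. -/
def toL2 (w : Weight) : H w ≃ₗᵢ[ℂ] lp (fun _ : ℕ+ => ℂ) 2 where
  toFun f := ⟨fun n => ((√(w n : ℝ) : ℝ) : ℂ) * f.coeff n, (summable_weighted_iff w _).1 f.summable⟩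
  invFun b := ⟨fun n => ((√(w n : ℝ) : ℝ) : ℂ)⁻¹ * b n, (summable_weighted_iff w _).2 (by
    convert lp.memℓp b using 1
    ext n
    have : ((√(w n : ℝ) : ℝ) : ℂ) ≠ 0 := by exact_mod_cast (Real.sqrt_pos.2 (w n).2).ne'
    exact mul_inv_cancel_left₀ this _)⟩
  map_add' f g := by
    ext n
    exact mul_add _ _ _
  map_smul' c f := by
    ext n
    exact mul_left_comm _ _ _
  left_inv f := by
    ext n
    have : ((√(w n : ℝ) : ℝ) : ℂ) ≠ 0 := by exact_mod_cast (Real.sqrt_pos.2 (w n).2).ne'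
    exact inv_mul_cancel_left₀ this _
  right_inv b := by
    ext n
    have : ((√(w n : ℝ) : ℝ) : ℂ) ≠ 0 := by exact_mod_cast (Real.sqrt_pos.2 (w n).2).ne'
    exact mul_inv_cancel_left₀ this _
  norm_map' f := by
    rw [← sq_eq_sq₀ (norm_nonneg _) (norm_nonneg _), H.norm_sq_eq]
    have h := lp.norm_rpow_eq_tsum (p := 2) (by norm_num)
      (⟨fun n => ((√(w n : ℝ) : ℝ) : ℂ) * f.coeff n, (summable_weighted_iff w _).1 f.summable⟩ :
        lp (fun _ : ℕ+ => ℂ) 2)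
    simp only [ENNReal.toReal_ofNat, Real.rpow_two] at h
    refine h.trans (tsum_congr fun n => ?_)
    simp only [norm_mul, Complex.norm_real, mul_pow, Real.norm_eq_abs, sq_abs,
      Real.sq_sqrt (w n).2.le]
    ring

instance (w : Weight) : CompleteSpace (H w) :=
  (toL2 w).toIsometryEquiv.completeSpace

/-- The value at `s` of the Dirichlet series `f ∈ H^w`. -/
def H.eval {w : Weight} (f : H w) (s : ℂ) : ℂ := ∑' n, dterm f.coeff s n

/-- The standing assumption on `σ₀`: `σ₀ > 0` and `∑ w_n⁻¹ n^{-2σ} < ∞` whenever `σ > σ₀`. -/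
def IsAdmissible (w : Weight) (σ₀ : ℝ) : Prop :=
  0 < σ₀ ∧ ∀ σ : ℝ, σ₀ < σ → Summable fun n : ℕ+ => (w n : ℝ)⁻¹ * ((n : ℕ) : ℝ) ^ (-2 * σ)

/-- Every `f ∈ H^w` converges absolutely in `Ω_{σ₀}`. -/
theorem H.summable_dterm {w : Weight} {σ₀ : ℝ} (hσ : IsAdmissible w σ₀) (f : H w) {s : ℂ}
    (hs : s ∈ Omega σ₀) : Summable (dterm f.coeff s) := by
  refine Summable.of_norm_bounded (f.summable.add (hσ.2 _ hs)) fun n => ?_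
  have hw := (w n).2
  have hn : (0 : ℝ) < ((n : ℕ) : ℝ) := by exact_mod_cast n.pos
  have h1 : ((n : ℕ) : ℝ) ^ (-2 * s.re) = (((n : ℕ) : ℝ) ^ (-s.re)) ^ 2 := by
    rw [← Real.rpow_natCast, ← Real.rpow_mul hn.le]
    congr 1
    push_cast
    ring
  rw [dterm, norm_mul, Complex.norm_natCast_cpow_of_pos n.pos, Complex.neg_re, h1]
  set x := ‖f.coeff n‖
  have hx : 0 ≤ x := norm_nonneg _
  set y := ((n : ℕ) : ℝ) ^ (-s.re)
  have hy : 0 ≤ y := Real.rpow_nonneg hn.le _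
  set v : ℝ := (w n : ℝ)
  have key : x ^ 2 * v + v⁻¹ * y ^ 2 - 2 * (x * y) = v⁻¹ * (x * v - y) ^ 2 := by
    field_simp
    ring
  have : 0 ≤ v⁻¹ * (x * v - y) ^ 2 := by positivity
  nlinarith [mul_nonneg hx hy]

/-! ### Multipliers -/

/-- `φ` (of which only the values on `Ω_{σ₀}` matter) is a multiplier of `H^w`: for each
`f ∈ H^w`, the function `φ f` on `Ω_{σ₀}` is (given by) an element of `H^w`. -/
def IsMultiplier (w : Weight) (σ₀ : ℝ) (φ : ℂ → ℂ) : Prop :=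
  ∀ f : H w, ∃ g : H w, ∀ s ∈ Omega σ₀, g.eval s = φ s * f.eval s

/-- The bounded operator `T` on `H^w` is multiplication by `φ`, that is, `T = M_φ`. -/
def IsMulOperator (w : Weight) (σ₀ : ℝ) (φ : ℂ → ℂ) (T : H w →L[ℂ] H w) : Prop :=
  ∀ f : H w, ∀ s ∈ Omega σ₀, (T f).eval s = φ s * f.eval s

/-- The multiplier algebra of `H^w`: the algebra of the operators `M_φ`, for `φ` a multiplier,
as a subalgebra of the bounded operators on `H^w` (with the operator norm). -/
def multiplierAlgebra (w : Weight) (σ₀ : ℝ) (hσ : IsAdmissible w σ₀) :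
    Subalgebra ℂ (H w →L[ℂ] H w) where
  carrier := {T | ∃ φ : ℂ → ℂ, IsMultiplier w σ₀ φ ∧ IsMulOperator w σ₀ φ T}
  mul_mem' := by
    rintro S T ⟨φ, -, hS⟩ ⟨ψ, -, hT⟩
    have h : IsMulOperator w σ₀ (fun s => φ s * ψ s) (S * T) := fun f s hs => by
      rw [mul_apply_eq_comp, hS _ s hs, hT _ s hs, mul_assoc]
    exact ⟨_, fun f => ⟨_, h f⟩, h⟩
  add_mem' := by
    rintro S T ⟨φ, -, hS⟩ ⟨ψ, -, hT⟩
    have h : IsMulOperator w σ₀ (fun s => φ s + ψ s) (S + T) := fun f s hs => by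
      rw [add_mul, ← hS _ s hs, ← hT _ s hs]
      unfold H.eval
      rw [← ((S f).summable_dterm hσ hs).tsum_add ((T f).summable_dterm hσ hs)]
      exact tsum_congr fun n => add_mul _ _ _
    exact ⟨_, fun f => ⟨_, h f⟩, h⟩
  algebraMap_mem' := by
    intro c
    have h : IsMulOperator w σ₀ (fun _ => c) (algebraMap ℂ (H w →L[ℂ] H w) c) := fun f s hs => by
      unfold H.eval
      rw [← tsum_mul_left]
      exact tsum_congr fun n => mul_assoc _ _ _
    exact ⟨_, fun f => ⟨_, h f⟩, h⟩

/-! ### Bounded analytic functions representable by a Dirichlet series -/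

/-- Membership in `𝒟`, for a function `φ` on `Ω_0`: in some right half-plane, `φ` is represented
by a (convergent) Dirichlet series. -/
def IsDirichletRepresentable (φ : Omega 0 → ℂ) : Prop :=
  ∃ (σ : ℝ) (a : ℕ+ → ℂ), ∀ s : Omega 0, σ < (s : ℂ).re → HasDirichletSum a s (φ s)

/-- `φ` is analytic on the open set `Ω_0`. -/
def IsHolomorphicOnOmega (φ : Omega 0 → ℂ) : Prop :=
  ∃ F : ℂ → ℂ, DifferentiableOn ℂ F (Omega 0) ∧ ∀ s : Omega 0, F s = φ s

theorem dterm_add (a b : ℕ+ → ℂ) (s : ℂ) (n : ℕ+) :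
    dterm (fun k => a k + b k) s n = dterm a s n + dterm b s n := add_mul _ _ _

theorem IsDirichletRepresentable.add {φ ψ : Omega 0 → ℂ} (hφ : IsDirichletRepresentable φ)
    (hψ : IsDirichletRepresentable ψ) : IsDirichletRepresentable fun s => φ s + ψ s := by
  obtain ⟨σ, a, ha⟩ := hφ
  obtain ⟨τ, b, hb⟩ := hψ
  refine ⟨max σ τ, fun n => a n + b n, fun s hs => ?_⟩
  have h := (ha s ((le_max_left _ _).trans_lt hs)).add (hb s ((le_max_right _ _).trans_lt hs))
  simpa only [HasDirichletSum, dterm_add, Finset.sum_add_distrib] using h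

theorem IsDirichletRepresentable.const (c : ℂ) : IsDirichletRepresentable fun _ => c := by
  refine ⟨0, fun n => if n = 1 then c else 0, fun s _ => ?_⟩
  refine tendsto_const_nhds.congr' ?_
  filter_upwards [eventually_ge_atTop 1] with N hN
  rw [Finset.sum_eq_single_of_mem 0 (Finset.mem_range.2 hN)]
  · have : Nat.succPNat 0 = 1 := rfl
    simp [dterm, this]
  · intro n _ hn
    have : n.succPNat ≠ 1 := fun h => hn (by
      have h2 := congrArg PNat.val h
      simpa using h2)
    simp [dterm, this]

/-- The coefficient sequence as a function on `ℕ`, with value `0` at `0`. -/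
def extendNat (a : ℕ+ → ℂ) (n : ℕ) : ℂ := if h : 0 < n then a ⟨n, h⟩ else 0

theorem term_extendNat (a : ℕ+ → ℂ) (s : ℂ) (n : ℕ) :
    LSeries.term (extendNat a) s (n + 1) = dterm a s n.succPNat := by
  rw [LSeries.term_of_ne_zero (Nat.succ_ne_zero n), dterm, Complex.cpow_neg, div_eq_mul_inv]
  simp [extendNat, Nat.succPNat]

theorem HasDirichletSum.of_lseries (c : ℕ → ℂ) {s z : ℂ} (h : LSeriesHasSum c s z) :
    HasDirichletSum (fun n => c n) s z := by
  have h1 := (hasSum_nat_add_iff' 1).2 h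
  simp only [Finset.range_one, Finset.sum_singleton, LSeries.term_zero, sub_zero] at h1
  refine h1.tendsto_sum_nat.congr fun N => Finset.sum_congr rfl fun n _ => ?_
  rw [LSeries.term_of_ne_zero (Nat.succ_ne_zero n), dterm, Complex.cpow_neg, div_eq_mul_inv]
  simp [Nat.succPNat]

theorem HasDirichletSum.lseries {a : ℕ+ → ℂ} {σ : ℝ} {s₀ z₀ s z : ℂ}
    (h₀ : HasDirichletSum a s₀ z₀) (hσ : s₀.re = σ) (hs : σ + 1 < s.re)
    (h : HasDirichletSum a s z) : LSeriesHasSum (extendNat a) s z := by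
  have hbd : ∃ C, ∀ n : ℕ, ‖dterm a s₀ n.succPNat‖ ≤ C := by
    have ht : Tendsto (fun n : ℕ => dterm a s₀ n.succPNat) atTop (𝓝 0) := by
      have := (h₀.comp (tendsto_add_atTop_nat 1)).sub h₀
      simpa [Function.comp_def, Finset.sum_range_succ] using this
    obtain ⟨C, hC⟩ := ht.norm.bddAbove_range
    exact ⟨C, fun n => hC ⟨n, rfl⟩⟩
  obtain ⟨C, hC⟩ := hbd
  have hsum : LSeriesSummable (extendNat a) s := by
    refine LSeriesSummable_of_le_const_mul_rpow (x := σ + 1) hs ⟨C, fun n hn => ?_⟩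
    obtain ⟨m, rfl⟩ := Nat.exists_eq_succ_of_ne_zero hn
    have hpos : (0 : ℝ) < ((m.succ : ℕ) : ℝ) := by positivity
    have h2 := hC m
    rw [← term_extendNat, LSeries.norm_term_eq, if_neg hn, hσ,
      div_le_iff₀ (Real.rpow_pos_of_pos hpos _)] at h2
    simpa using h2
  have h3 := (hasSum_nat_add_iff' 1).2 hsum.LSeriesHasSum
  simp only [Finset.range_one, Finset.sum_singleton, LSeries.term_zero, sub_zero,
    term_extendNat] at h3
  rw [tendsto_nhds_unique h h3.tendsto_sum_nat]
  exact hsum.LSeriesHasSum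

theorem IsDirichletRepresentable.mul {φ ψ : Omega 0 → ℂ} (hφ : IsDirichletRepresentable φ)
    (hψ : IsDirichletRepresentable ψ) : IsDirichletRepresentable fun s => φ s * ψ s := by
  obtain ⟨σ, a, ha⟩ := hφ
  obtain ⟨τ, b, hb⟩ := hψ
  set ρ : ℝ := max (max σ τ) 0 + 1
  have hρσ : σ < ρ := by
    have := (le_max_left σ τ).trans (le_max_left (max σ τ) 0); linarith
  have hρτ : τ < ρ := by
    have := (le_max_right σ τ).trans (le_max_left (max σ τ) 0); linarith
  have hρ0 : 0 < ρ := by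
    have := le_max_right (max σ τ) 0; linarith
  have h0 : (ρ : ℂ) ∈ Omega 0 := by simpa [Omega] using hρ0
  refine ⟨ρ + 1, fun n => LSeries.convolution (extendNat a) (extendNat b) n, fun s hs => ?_⟩
  have h1 := (ha ⟨ρ, h0⟩ (by simpa using hρσ)).lseries (Complex.ofReal_re ρ) hs
    (ha s (by linarith))
  have h2 := (hb ⟨ρ, h0⟩ (by simpa using hρτ)).lseries (Complex.ofReal_re ρ) hs
    (hb s (by linarith))
  exact HasDirichletSum.of_lseries _ (h1.convolution h2)

/-- The algebra `H^∞(Ω_0) ∩ 𝒟` of the bounded analytic functions on `Ω_0` which are representable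
by a Dirichlet series in some right half-plane, with the supremum norm (inherited from the
bounded continuous functions on `Ω_0`). -/
def hInfDirichlet : Subalgebra ℂ (Omega 0 →ᵇ ℂ) where
  carrier := {φ | IsHolomorphicOnOmega φ ∧ IsDirichletRepresentable φ}
  mul_mem' := by
    rintro φ ψ ⟨⟨F, hF, hFφ⟩, hφ⟩ ⟨⟨G, hG, hGψ⟩, hψ⟩
    exact ⟨⟨fun s => F s * G s, hF.mul hG, fun s => by simp [hFφ, hGψ]⟩, hφ.mul hψ⟩
  add_mem' := by
    rintro φ ψ ⟨⟨F, hF, hFφ⟩, hφ⟩ ⟨⟨G, hG, hGψ⟩, hψ⟩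
    exact ⟨⟨fun s => F s + G s, hF.add hG, fun s => by simp [hFφ, hGψ]⟩, hφ.add hψ⟩
  algebraMap_mem' := by
    intro c
    exact ⟨⟨fun _ => c, differentiableOn_const c, fun s => rfl⟩, .const c⟩

/-! ### Weights given by measures -/

theorem integral_weight_pos (μ : Measure ℝ≥0) [IsProbabilityMeasure μ] (n : ℕ+) :
    0 < ∫ σ, ((n : ℕ) : ℝ) ^ (-2 * (σ : ℝ)) ∂μ := by
  have hn : (1 : ℝ) ≤ ((n : ℕ) : ℝ) := by exact_mod_cast n.pos
  have hpos : ∀ σ : ℝ≥0, 0 < ((n : ℕ) : ℝ) ^ (-2 * (σ : ℝ)) := fun σ =>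
    Real.rpow_pos_of_pos (by linarith) _
  have hint : Integrable (fun σ : ℝ≥0 => ((n : ℕ) : ℝ) ^ (-2 * (σ : ℝ))) μ := by
    refine Integrable.of_bound (C := 1) (Measurable.aestronglyMeasurable (by fun_prop)) (ae_of_all _ fun σ => ?_)
    rw [Real.norm_eq_abs, abs_of_pos (hpos σ)]
    exact Real.rpow_le_one_of_one_le_of_nonpos hn (by simp)
  rw [integral_pos_iff_support_of_nonneg (fun σ => (hpos σ).le) hint]
  have : Function.support (fun σ : ℝ≥0 => ((n : ℕ) : ℝ) ^ (-2 * (σ : ℝ))) = Set.univ :=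
    Set.eq_univ_of_forall fun σ => (hpos σ).ne'
  rw [this]
  simp

/-- The weights `w_n = ∫_{[0,∞)} n^{-2σ} dμ(σ)` of a Borel probability measure `μ` on `[0,∞)`. -/
def measureWeight (μ : Measure ℝ≥0) [IsProbabilityMeasure μ] : Weight := fun n =>
  ⟨∫ σ, ((n : ℕ) : ℝ) ^ (-2 * (σ : ℝ)) ∂μ, integral_weight_pos μ n⟩

end DirichletMult

end

open DirichletMult

namespace DirichletMult

/-! ### Dirichlet series indexed by positive integers as `LSeries` -/

/-! The two algebras are matched by two norm-decreasing maps, inverse to each other because an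
operator and its symbol determine one another.

From functions to operators. Let F be bounded by M on `Omega 0`, with coefficients b. Cauchy's
theorem moves mean values on vertical lines from the half-plane of absolute convergence to any line
Re s = σ > 0, so coefficients of F times a Dirichlet polynomial can be read off there although the
series of F need not converge (`tendsto_vmean_coeff`). A mean-square comparison gives ∑ |(b*p)_n|²
n^{-2σ} ≤ M² ∑ |p_n|² n^{-2σ} for polynomials p (`sum_sq_convolution_le`). Letting σ → 0 covers σ =
0, and integrating against μ turns n^{-2σ} into w_n: convolution by b has norm at most M on H^w
(`sum_sq_dconv_le`).

From operators to functions. A multiplier operator T is convolution by the coefficients of T 1. Keep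
only the n whose prime factors are below N. This restriction respects convolution, and the
restricted evaluation at s is a bounded functional for every s in `Omega 0`: sums over such n form a
finite Euler product, and 0 in the support of μ keeps w_n above c n^{-ε}. The functional is an
eigenvector of the adjoint of T, with eigenvalue the restricted sum of T 1 at s, so that sum is at
most ‖T‖ (`norm_LSeries_smoothPart_le`). As N → ∞ a normal-families argument yields an extension of
φ to `Omega 0` bounded by ‖T‖ (`exists_differentiableOn_extension`). -/

@[simp] theorem extendNat_zero (a : ℕ+ → ℂ) : extendNat a 0 = 0 := by simp [extendNat]

@[simp] theorem extendNat_coe (a : ℕ+ → ℂ) (n : ℕ+) : extendNat a n = a n := dif_pos n.pos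

theorem term_extendNat_coe (a : ℕ+ → ℂ) (s : ℂ) (n : ℕ+) :
    LSeries.term (extendNat a) s n = dterm a s n := by
  rw [LSeries.term_of_ne_zero n.ne_zero, dterm, Complex.cpow_neg, div_eq_mul_inv, extendNat_coe]

theorem hasSum_dterm_iff {a : ℕ+ → ℂ} {s z : ℂ} :
    HasSum (dterm a s) z ↔ LSeriesHasSum (extendNat a) s z := by
  rw [LSeriesHasSum, ← Function.Injective.hasSum_iff PNat.coe_injective]
  · rw [show LSeries.term (extendNat a) s ∘ PNat.val = dterm a s from
      funext fun n => term_extendNat_coe a s n]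
  · intro n hn
    rcases Nat.eq_zero_or_pos n with rfl | h
    · simp
    · exact absurd ⟨⟨n, h⟩, rfl⟩ hn

theorem summable_dterm_iff {a : ℕ+ → ℂ} {s : ℂ} :
    Summable (dterm a s) ↔ LSeriesSummable (extendNat a) s :=
  ⟨fun h => (hasSum_dterm_iff.1 h.hasSum).LSeriesSummable,
    fun h => (hasSum_dterm_iff.2 h.LSeriesHasSum).summable⟩

theorem tsum_dterm (a : ℕ+ → ℂ) (s : ℂ) : ∑' n, dterm a s n = LSeries (extendNat a) s := by
  by_cases h : Summable (dterm a s)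
  · exact (hasSum_dterm_iff.1 h.hasSum).LSeries_eq.symm
  · rw [tsum_eq_zero_of_not_summable h,
      LSeries.eq_zero_of_not_LSeriesSummable _ _ (mt summable_dterm_iff.2 h)]

theorem H.eval_eq_LSeries {w : Weight} (f : H w) (s : ℂ) :
    f.eval s = LSeries (extendNat f.coeff) s := tsum_dterm _ _

theorem H.lseriesSummable {w : Weight} {σ₀ : ℝ} (hσ : IsAdmissible w σ₀) (f : H w) {s : ℂ}
    (hs : s ∈ Omega σ₀) : LSeriesSummable (extendNat f.coeff) s :=
  summable_dterm_iff.1 (f.summable_dterm hσ hs)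

theorem abscissaOfAbsConv_le_of_summable {a : ℕ → ℂ} {σ : ℝ}
    (h : ∀ s ∈ Omega σ, LSeriesSummable a s) : LSeries.abscissaOfAbsConv a ≤ σ :=
  LSeries.abscissaOfAbsConv_le_of_forall_lt_LSeriesSummable fun y hy =>
    h y (by simpa [Omega] using hy)

theorem differentiableOn_LSeries_omega {a : ℕ → ℂ} {σ : ℝ}
    (h : ∀ s ∈ Omega σ, LSeriesSummable a s) : DifferentiableOn ℂ (LSeries a) (Omega σ) :=
  (LSeries_differentiableOn a).mono fun _ hs =>
    (abscissaOfAbsConv_le_of_summable h).trans_lt (EReal.coe_lt_coe_iff.2 hs)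

/-- A Dirichlet series absolutely convergent in a half-plane is determined by its sum on any
smaller half-plane. -/
theorem eq_of_LSeries_eqOn {a b : ℕ → ℂ} {σ : ℝ} (ha : ∀ s ∈ Omega σ, LSeriesSummable a s)
    (hb : ∀ s ∈ Omega σ, LSeriesSummable b s)
    (h : ∀ s ∈ Omega σ, LSeries a s = LSeries b s) {n : ℕ} (hn : n ≠ 0) : a n = b n := by
  refine LSeries.eq_of_LSeries_eventually_eq
    ((abscissaOfAbsConv_le_of_summable ha).trans_lt (EReal.coe_lt_top _))
    ((abscissaOfAbsConv_le_of_summable hb).trans_lt (EReal.coe_lt_top _)) ?_ hn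
  filter_upwards [eventually_gt_atTop σ] with x hx
  exact h x (by simpa [Omega] using hx)

theorem H.ext_eval {w : Weight} {σ₀ : ℝ} (hσ : IsAdmissible w σ₀) {f g : H w}
    (h : ∀ s ∈ Omega σ₀, f.eval s = g.eval s) : f = g := by
  ext n
  have := eq_of_LSeries_eqOn (fun _ => f.lseriesSummable hσ) (fun _ => g.lseriesSummable hσ)
    (fun s hs => by rw [← H.eval_eq_LSeries, ← H.eval_eq_LSeries, h s hs]) n.ne_zero
  simpa using this

theorem isOpen_omega (δ : ℝ) : IsOpen (Omega δ) := isOpen_lt continuous_const Complex.continuous_re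

theorem convex_omega (δ : ℝ) : Convex ℝ (Omega δ) := convex_halfSpace_re_gt δ

theorem omega_subset {δ ε : ℝ} (h : δ ≤ ε) : Omega ε ⊆ Omega δ := fun _ hs => h.trans_lt hs

/-- Holomorphic functions on a half-plane that agree on a smaller half-plane are equal. -/
theorem eqOn_omega_of_eqOn {F G : ℂ → ℂ} {δ ε : ℝ} (hF : DifferentiableOn ℂ F (Omega δ))
    (hG : DifferentiableOn ℂ G (Omega δ)) (h : ∀ s ∈ Omega ε, F s = G s) :
    Set.EqOn F G (Omega δ) := by
  set c : ℂ := ((max δ ε + 1 : ℝ) : ℂ)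
  have hδ : c ∈ Omega δ := by
    have := le_max_left δ ε
    simp only [Omega, c, Set.mem_ofPred_eq, Complex.ofReal_re]; linarith
  have hε : c ∈ Omega ε := by
    have := le_max_right δ ε
    simp only [Omega, c, Set.mem_ofPred_eq, Complex.ofReal_re]; linarith
  refine (hF.analyticOnNhd (isOpen_omega δ)).eqOn_of_preconnected_of_eventuallyEq
    (hG.analyticOnNhd (isOpen_omega δ)) (convex_omega δ).isPreconnected hδ ?_
  filter_upwards [(isOpen_omega ε).mem_nhds hε] with s hs using h s hs

/-! ### Dirichlet convolution -/

/-- The Dirichlet convolution of two coefficient sequences. -/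
noncomputable def dconv (a b : ℕ+ → ℂ) (n : ℕ+) : ℂ := LSeries.convolution (extendNat a) (extendNat b) n

theorem extendNat_dconv (a b : ℕ+ → ℂ) : extendNat (dconv a b) = LSeries.convolution (extendNat a) (extendNat b) := by
  ext n
  rcases Nat.eq_zero_or_pos n with rfl | h
  · simp
  · exact extendNat_coe _ ⟨n, h⟩

theorem dconv_apply (a b : ℕ+ → ℂ) (n : ℕ+) :
    dconv a b n = ∑ p ∈ (n : ℕ).divisorsAntidiagonal, extendNat a p.1 * extendNat b p.2 := by
  rw [dconv, LSeries.convolution_def]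

/-- The coefficients of the constant function `1`. -/
def oneCoeff (n : ℕ+) : ℂ := if n = 1 then 1 else 0

/-- The constant function `1`, as an element of `H^w`. -/
def H.one (w : Weight) : H w :=
  ⟨oneCoeff, summable_of_ne_finset_zero (s := {1}) fun n hn => by
    simp [oneCoeff, Finset.notMem_singleton.1 hn]⟩

theorem H.eval_one (w : Weight) (s : ℂ) : (H.one w).eval s = 1 := by
  rw [H.eval, tsum_eq_single 1]
  · simp [dterm, H.one, H.coeff, oneCoeff]
  · intro n hn
    simp [dterm, H.one, H.coeff, oneCoeff, hn]

/-! ### Mean values on vertical lines -/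

/-- The mean value of `h` over `[-T, T]`. -/
noncomputable def vmean (h : ℝ → ℂ) (T : ℝ) : ℂ := ((2 * T : ℝ) : ℂ)⁻¹ * ∫ t in -T..T, h t

theorem norm_vmean_le {h : ℝ → ℂ} {C T : ℝ} (hT : 0 < T) (hC : ∀ t, ‖h t‖ ≤ C) :
    ‖vmean h T‖ ≤ C := by
  have h1 := intervalIntegral.norm_integral_le_of_norm_le_const (a := -T) (b := T) (f := h)
    fun t _ => hC t
  have h2 : |T - -T| = 2 * T := by rw [abs_of_pos] <;> linarith
  rw [vmean, norm_mul, norm_inv, Complex.norm_real, Real.norm_eq_abs, abs_of_pos (by linarith),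
    inv_mul_le_iff₀ (by linarith)]
  linarith [h2 ▸ h1]

theorem vmean_const_mul (c : ℂ) (h : ℝ → ℂ) (T : ℝ) :
    vmean (fun t => c * h t) T = c * vmean h T := by
  rw [vmean, vmean, intervalIntegral.integral_const_mul]
  ring

theorem vmean_add {g h : ℝ → ℂ} (hg : Continuous g) (hh : Continuous h) (T : ℝ) :
    vmean (fun t => g t + h t) T = vmean g T + vmean h T := by
  rw [vmean, vmean, vmean, intervalIntegral.integral_add (hg.intervalIntegrable _ _)
    (hh.intervalIntegrable _ _)]
  ring

theorem vmean_finset_sum {ι : Type*} (K : Finset ι) {h : ι → ℝ → ℂ}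
    (hh : ∀ i ∈ K, Continuous (h i)) (T : ℝ) :
    vmean (fun t => ∑ i ∈ K, h i t) T = ∑ i ∈ K, vmean (h i) T := by
  simp only [vmean]
  rw [intervalIntegral.integral_finsetSum fun i hi => (hh i hi).intervalIntegrable _ _,
    Finset.mul_sum]

theorem re_vmean_nonneg {h : ℝ → ℂ} (hh : Continuous h) (h0 : ∀ t, 0 ≤ (h t).re) {T : ℝ}
    (hT : 0 < T) : 0 ≤ (vmean h T).re := by
  rw [vmean, ← Complex.ofReal_inv, Complex.re_ofReal_mul]
  refine mul_nonneg (by positivity) ?_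
  have := Complex.reCLM.intervalIntegral_comp_comm (hh.intervalIntegrable (μ := volume) (-T) T)
  simp only [Complex.reCLM_apply] at this
  rw [← this]
  exact intervalIntegral.integral_nonneg (by linarith) fun t _ => h0 t

/-- Orthogonality of the characters t ↦ e^{ixt} in the mean: for x ≠ 0 the integral stays below
2/|x| while the length 2T grows. -/
theorem tendsto_vmean_exp (x : ℝ) :
    Tendsto (vmean fun t => Complex.exp (x * Complex.I * t)) atTop (𝓝 (if x = 0 then 1 else 0)) := by
  split_ifs with hx
  · refine tendsto_const_nhds.congr' ?_
    filter_upwards [eventually_gt_atTop 0] with T hT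
    have : (2 * T : ℂ) ≠ 0 := by simpa using hT.ne'
    simp only [vmean, hx, Complex.ofReal_zero, zero_mul, Complex.exp_zero,
      intervalIntegral.integral_const, Complex.real_smul]
    push_cast
    rw [show (T : ℂ) - -T = 2 * T by ring, mul_one, inv_mul_cancel₀ this]
  · have hc : (x : ℂ) * Complex.I ≠ 0 := by simpa using hx
    have h1 : Tendsto (fun T : ℝ => (2 * T)⁻¹ * (2 / |x|)) atTop (𝓝 0) := by
      have := (tendsto_id.const_mul_atTop (two_pos : (0 : ℝ) < 2)).inv_tendsto_atTop.mul_const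
        (2 / |x|)
      simpa using this
    refine squeeze_zero_norm' ?_ h1
    filter_upwards [eventually_gt_atTop 0] with T hT
    rw [vmean, integral_exp_mul_complex hc, norm_mul, norm_inv, Complex.norm_real,
      Real.norm_eq_abs, abs_of_pos (by linarith), norm_div]
    have h2 (y : ℝ) : ‖Complex.exp (x * Complex.I * y)‖ = 1 := by
      rw [show (x : ℂ) * Complex.I * y = ((x * y : ℝ) : ℂ) * Complex.I by push_cast; ring,
        Complex.norm_exp_ofReal_mul_I]
    have h3 : ‖(x : ℂ) * Complex.I‖ = |x| := by simp
    rw [h3]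
    gcongr
    refine (norm_sub_le _ _).trans ?_
    rw [h2, h2]
    norm_num

/-- Isolates the dependence on t, which is the pure oscillation (n/m)^{it}. -/
theorem term_mul_cpow (c : ℕ → ℂ) (x t : ℝ) (m : ℕ) {n : ℕ} (hn : n ≠ 0) :
    LSeries.term c (x + t * Complex.I) m * (n : ℂ) ^ ((x : ℂ) + t * Complex.I) =
      LSeries.term c x m * (n : ℂ) ^ (x : ℂ) *
        Complex.exp (((Real.log n - Real.log m : ℝ) : ℂ) * Complex.I * t) := by
  rcases eq_or_ne m 0 with rfl | hm
  · simp
  · have hn' : (n : ℂ) ≠ 0 := by exact_mod_cast hn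
    have hm' : (m : ℂ) ≠ 0 := by exact_mod_cast hm
    rw [LSeries.term_of_ne_zero hm, LSeries.term_of_ne_zero hm, Complex.cpow_add _ _ hn',
      Complex.cpow_add _ _ hm']
    have h1 : Complex.exp (((Real.log n - Real.log m : ℝ) : ℂ) * Complex.I * t) =
        (n : ℂ) ^ (t * Complex.I) / (m : ℂ) ^ (t * Complex.I) := by
      rw [Complex.cpow_def_of_ne_zero hn', Complex.cpow_def_of_ne_zero hm', ← Complex.exp_sub]
      rw [Complex.ofReal_sub, Complex.natCast_log, Complex.natCast_log]
      ring_nf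
    rw [h1]
    ring

/-- A coefficient of an absolutely convergent Dirichlet series as a mean value. -/
theorem tendsto_vmean_of_summable {G : ℂ → ℂ} {c : ℕ → ℂ} {x : ℝ}
    (hc : ∀ t : ℝ, LSeriesHasSum c (x + t * Complex.I) (G (x + t * Complex.I))) {n : ℕ}
    (hn : n ≠ 0) :
    Tendsto (vmean fun t => G (x + t * Complex.I) * (n : ℂ) ^ ((x : ℂ) + t * Complex.I)) atTop
      (𝓝 (c n)) := by
  set e : ℕ → ℝ → ℂ := fun m t =>
    Complex.exp (((Real.log n - Real.log m : ℝ) : ℂ) * Complex.I * t)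
  have he (m : ℕ) (t : ℝ) : ‖e m t‖ = 1 := by
    simp only [e]
    rw [show ((Real.log n - Real.log m : ℝ) : ℂ) * Complex.I * t =
      (((Real.log n - Real.log m) * t : ℝ) : ℂ) * Complex.I by push_cast; ring,
      Complex.norm_exp_ofReal_mul_I]
  have hec (m : ℕ) : Continuous (e m) := by fun_prop
  set u : ℕ → ℂ := fun m => LSeries.term c x m * (n : ℂ) ^ (x : ℂ)
  have hu : Summable u := by
    have := (hc 0).summable.mul_right ((n : ℂ) ^ (x : ℂ))
    simpa using this
  have h1 (t : ℝ) : HasSum (fun m => u m * e m t)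
      (G (x + t * Complex.I) * (n : ℂ) ^ ((x : ℂ) + t * Complex.I)) := by
    simpa only [term_mul_cpow c x t _ hn] using (hc t).mul_right ((n : ℂ) ^ ((x : ℂ) + t * Complex.I))
  have h2 (T : ℝ) : vmean (fun t => G (x + t * Complex.I) * (n : ℂ) ^ ((x : ℂ) + t * Complex.I)) T =
      ∑' m, u m * vmean (e m) T := by
    have h3 := intervalIntegral.hasSum_integral_of_dominated_convergence (μ := volume)
      (a := -T) (b := T) (F := fun m t => u m * e m t)
      (f := fun t => G (x + t * Complex.I) * (n : ℂ) ^ ((x : ℂ) + t * Complex.I))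
      (fun m _ => ‖u m‖) (fun m => (continuous_const.mul (hec m)).aestronglyMeasurable)
      (fun m => ae_of_all _ fun t _ => by rw [norm_mul, he, mul_one])
      (ae_of_all _ fun t _ => hu.norm) intervalIntegrable_const (ae_of_all _ fun t _ => h1 t)
    have h4 := (h3.mul_left ((2 * T : ℝ) : ℂ)⁻¹).tsum_eq
    rw [vmean, ← h4]
    exact tsum_congr fun m => vmean_const_mul _ _ _
  have h5 : c n = ∑' m, u m * (if Real.log n - Real.log m = 0 then 1 else 0) := by
    rw [tsum_eq_single n]
    · have hn' : (n : ℂ) ^ (x : ℂ) ≠ 0 := by simp [Complex.cpow_eq_zero_iff, hn]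
      simp [u, LSeries.term_of_ne_zero hn, hn']
    · intro m hm
      -- Since `Real.log 0 = 0`, for n = 1 the index m = 0 also has zero frequency; it is harmless
      -- because the zeroth term of an `LSeries` is 0.
      rcases eq_or_ne m 0 with rfl | hm0
      · simp [u]
      · rw [if_neg, mul_zero]
        intro h
        have h6 := Real.log_injOn_pos (x₁ := (n : ℝ)) (x₂ := (m : ℝ))
          (by simpa using Nat.pos_of_ne_zero hn) (by simpa using Nat.pos_of_ne_zero hm0) (by linarith)
        exact hm (by exact_mod_cast h6.symm)
  rw [h5, funext h2]
  refine tendsto_tsum_of_dominated_convergence hu.norm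
    (fun m => (tendsto_vmean_exp _).const_mul _) ?_
  filter_upwards [eventually_gt_atTop 0] with T hT m
  rw [norm_mul]
  exact mul_le_of_le_one_right (norm_nonneg _) (norm_vmean_le hT fun t => (he m t).le)

/-- The difference of the mean values of a bounded holomorphic function on two vertical lines
tends to `0`. -/
theorem tendsto_vmean_sub {E : ℂ → ℂ} {B x y : ℝ} (hxy : x ≤ y)
    (hE : ∀ s : ℂ, x ≤ s.re → DifferentiableAt ℂ E s)
    (hB : ∀ s : ℂ, x ≤ s.re → s.re ≤ y → ‖E s‖ ≤ B) :
    Tendsto (fun T => vmean (fun t => E (y + t * Complex.I)) T -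
      vmean (fun t => E (x + t * Complex.I)) T) atTop (𝓝 0) := by
  have h1 : Tendsto (fun T : ℝ => (2 * T)⁻¹ * (2 * (B * (y - x)))) atTop (𝓝 0) := by
    have := (tendsto_id.const_mul_atTop (two_pos : (0 : ℝ) < 2)).inv_tendsto_atTop.mul_const
      (2 * (B * (y - x)))
    simpa using this
  refine squeeze_zero_norm' ?_ h1
  filter_upwards [eventually_gt_atTop 0] with T hT
  -- Cauchy on the rectangle [x, y] × [-T, T]: each horizontal side contributes at most B(y - x),
  -- independently of T, and dies after division by 2T.
  have h2 := Complex.integral_boundary_rect_eq_zero_of_differentiableOn E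
    ((x : ℂ) + (-T : ℝ) * Complex.I) ((y : ℂ) + (T : ℝ) * Complex.I) fun s hs => by
      refine (hE s ?_).differentiableWithinAt
      have := (Complex.mem_reProdIm.1 hs).1
      simp [Set.uIcc_of_le hxy] at this
      exact this.1
  simp only [Complex.add_re, Complex.add_im, Complex.ofReal_re, Complex.ofReal_im, Complex.mul_re,
    Complex.mul_im, Complex.I_re, Complex.I_im, mul_zero, mul_one, zero_add, add_zero, sub_zero,
    smul_eq_mul] at h2
  have h3 (r : ℝ) : ‖∫ t in x..y, E (t + r * Complex.I)‖ ≤ B * (y - x) := by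
    have := intervalIntegral.norm_integral_le_of_norm_le_const (a := x) (b := y) (C := B)
      (f := fun t : ℝ => E (t + r * Complex.I)) fun t ht => by
        rw [Set.uIoc_of_le hxy] at ht
        exact hB _ (by simpa using ht.1.le) (by simpa using ht.2)
    rwa [abs_of_nonneg (by linarith)] at this
  set U := ∫ t in (-T)..T, E (y + t * Complex.I)
  set V := ∫ t in (-T)..T, E (x + t * Complex.I)
  have h4 : ‖U - V‖ ≤ 2 * (B * (y - x)) := by
    have : Complex.I * (U - V) = (∫ t in x..y, E (t + (T : ℝ) * Complex.I)) -
        ∫ t in x..y, E (t + (-T : ℝ) * Complex.I) := by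
      linear_combination h2
    have h5 := norm_sub_le (∫ t in x..y, E (t + (T : ℝ) * Complex.I))
      (∫ t in x..y, E (t + (-T : ℝ) * Complex.I))
    rw [← this, norm_mul, Complex.norm_I, one_mul] at h5
    linarith [h3 T, h3 (-T)]
  rw [vmean, vmean, ← mul_sub, norm_mul, norm_inv, Complex.norm_real, Real.norm_eq_abs,
    abs_of_pos (by linarith)]
  gcongr

/-- The coefficients of a bounded holomorphic function on `Ω_0` that is an absolutely convergent
Dirichlet series in some half-plane are mean values on each vertical line in `Ω_0`. -/
theorem tendsto_vmean_coeff {G : ℂ → ℂ} {c : ℕ → ℂ} {B ρ σ : ℝ}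
    (hG : DifferentiableOn ℂ G (Omega 0)) (hB : ∀ s ∈ Omega 0, ‖G s‖ ≤ B)
    (hc : ∀ s ∈ Omega ρ, LSeriesHasSum c s (G s)) (hσ : 0 < σ) {n : ℕ} (hn : n ≠ 0) :
    Tendsto (vmean fun t => G (σ + t * Complex.I) * (n : ℂ) ^ ((σ : ℂ) + t * Complex.I)) atTop
      (𝓝 (c n)) := by
  -- A line inside the half-plane of absolute convergence and to the right of σ; on the strip
  -- between, G(s) n^s is bounded by B n^y.
  set y := max ρ σ + 1
  have hy1 : ρ < y := by have := le_max_left ρ σ; linarith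
  have hy2 : σ < y := by have := le_max_right ρ σ; linarith
  have hB0 : 0 ≤ B := (norm_nonneg _).trans (hB 1 (by simp [Omega]))
  have hn' : (n : ℂ) ≠ 0 := by exact_mod_cast hn
  have hn1 : (1 : ℝ) ≤ n := by exact_mod_cast Nat.one_le_iff_ne_zero.2 hn
  have h1 := tendsto_vmean_of_summable (G := G) (c := c) (x := y)
    (fun t => hc _ (by simpa [Omega] using hy1)) hn
  have h2 := tendsto_vmean_sub (E := fun s => G s * (n : ℂ) ^ s) (B := B * (n : ℝ) ^ y) hy2.le
    (fun s hs => by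
      have h0 : s ∈ Omega 0 := hσ.trans_le hs
      exact (hG.differentiableAt ((isOpen_omega 0).mem_nhds h0)).mul
        (differentiableAt_id.const_cpow (Or.inl hn')))
    (fun s hs hs' => by
      rw [norm_mul, Complex.norm_natCast_cpow_of_pos (Nat.pos_of_ne_zero hn)]
      gcongr
      exact hB s (hσ.trans_le hs))
  simpa using h1.sub h2

/-! ### Dirichlet polynomials -/

/-- The Dirichlet polynomial `∑_{n ∈ K} q_n n^{-s}`. -/
noncomputable def dpoly (q : ℕ → ℂ) (K : Finset ℕ) (s : ℂ) : ℂ := ∑ n ∈ K, q n * (n : ℂ) ^ (-s)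

theorem differentiable_dpoly (q : ℕ → ℂ) {K : Finset ℕ} (hK : 0 ∉ K) :
    Differentiable ℂ (dpoly q K) := by
  refine Differentiable.fun_sum fun n hn => ?_
  have hn' : (n : ℂ) ≠ 0 := by
    rintro h
    exact hK (by rwa [Nat.cast_eq_zero.1 h] at hn)
  exact (differentiable_id.neg.const_cpow (Or.inl hn')).const_mul _

theorem norm_dpoly_le (q : ℕ → ℂ) {K : Finset ℕ} (hK : 0 ∉ K) {s : ℂ} (hs : s ∈ Omega 0) :
    ‖dpoly q K s‖ ≤ ∑ n ∈ K, ‖q n‖ := by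
  refine norm_sum_le_of_le _ fun n hn => ?_
  have hn0 : n ≠ 0 := fun h => hK (h ▸ hn)
  have hs' : 0 < s.re := hs
  rw [norm_mul, Complex.norm_natCast_cpow_of_pos (Nat.pos_of_ne_zero hn0)]
  refine mul_le_of_le_one_right (norm_nonneg _) (Real.rpow_le_one_of_one_le_of_nonpos ?_ ?_)
  · exact_mod_cast Nat.one_le_iff_ne_zero.2 hn0
  · simpa using hs'.le

theorem lseriesHasSum_dpoly {q : ℕ → ℂ} {K : Finset ℕ} (hK : 0 ∉ K) (hq : ∀ n ∉ K, q n = 0)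
    (s : ℂ) : LSeriesHasSum q s (dpoly q K s) := by
  have h1 : dpoly q K s = ∑ n ∈ K, LSeries.term q s n := by
    refine Finset.sum_congr rfl fun n hn => ?_
    rw [LSeries.term_of_ne_zero (fun h => hK (h ▸ hn)), Complex.cpow_neg, div_eq_mul_inv]
  rw [h1]
  refine hasSum_sum_of_ne_finset_zero fun n hn => ?_
  rcases eq_or_ne n 0 with rfl | h0
  · simp
  · simp [LSeries.term_of_ne_zero h0, hq n hn]

/-- On the line Re s = σ one has conj(n^{-s}) = n^{-2σ} n^s, so pairing with a conjugated polynomial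
becomes a combination of the means that extract coefficients. -/
theorem conj_dpoly_vertical (q : ℕ → ℂ) {K : Finset ℕ} (hK : 0 ∉ K) (σ t : ℝ) :
    conj (dpoly q K (σ + t * Complex.I)) = ∑ n ∈ K, conj (q n) * (((n : ℝ) ^ (-2 * σ) : ℝ) : ℂ) *
      (n : ℂ) ^ ((σ : ℂ) + t * Complex.I) := by
  rw [dpoly, map_sum]
  refine Finset.sum_congr rfl fun n hn => ?_
  have hn' : (n : ℂ) ≠ 0 := by
    rintro h
    exact hK (by rwa [Nat.cast_eq_zero.1 h] at hn)
  rw [map_mul, mul_assoc, Complex.ofReal_cpow n.cast_nonneg, Complex.ofReal_natCast,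
    ← Complex.cpow_add _ _ hn']
  congr 1
  have h1 := Complex.cpow_conj (n : ℂ) (-(σ + t * Complex.I))
    (by rw [Complex.natCast_arg]; exact Real.pi_pos.ne)
  rw [Complex.conj_natCast] at h1
  rw [← h1]
  congr 1
  simp
  ring

theorem continuous_vertical {G : ℂ → ℂ} (hG : DifferentiableOn ℂ G (Omega 0)) {σ : ℝ}
    (hσ : 0 < σ) : Continuous fun t : ℝ => G (σ + t * Complex.I) :=
  hG.continuousOn.comp_continuous (by fun_prop) fun t => by simpa [Omega] using hσ

/-- Polarized Carlson formula: the mean of G times a conjugated polynomial is the ℓ² pairing of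
coefficients with weight n^{-2σ}. One factor being a polynomial, only finitely many coefficient
limits are needed. -/
theorem tendsto_vmean_mul_conj_dpoly {G : ℂ → ℂ} {c : ℕ → ℂ} {B ρ σ : ℝ}
    (hG : DifferentiableOn ℂ G (Omega 0)) (hB : ∀ s ∈ Omega 0, ‖G s‖ ≤ B)
    (hc : ∀ s ∈ Omega ρ, LSeriesHasSum c s (G s)) (hσ : 0 < σ) (q : ℕ → ℂ) {K : Finset ℕ}
    (hK : 0 ∉ K) :
    Tendsto (vmean fun t => G (σ + t * Complex.I) * conj (dpoly q K (σ + t * Complex.I))) atTop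
      (𝓝 (∑ n ∈ K, conj (q n) * (((n : ℝ) ^ (-2 * σ) : ℝ) : ℂ) * c n)) := by
  have h1 : (fun T => ∑ n ∈ K, conj (q n) * (((n : ℝ) ^ (-2 * σ) : ℝ) : ℂ) *
      vmean (fun t => G (σ + t * Complex.I) * (n : ℂ) ^ ((σ : ℂ) + t * Complex.I)) T) =
      vmean fun t => G (σ + t * Complex.I) * conj (dpoly q K (σ + t * Complex.I)) := by
    ext T
    simp only [← vmean_const_mul]
    rw [← vmean_finset_sum]
    · congr 1
      ext t
      rw [conj_dpoly_vertical q hK, Finset.mul_sum]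
      exact Finset.sum_congr rfl fun n _ => by ring
    · intro n hn
      have hn' : (n : ℂ) ≠ 0 := by
        rintro h
        exact hK (by rwa [Nat.cast_eq_zero.1 h] at hn)
      exact continuous_const.mul ((continuous_vertical hG hσ).mul
        (Continuous.const_cpow (by fun_prop) (Or.inl hn')))
  rw [← h1]
  exact tendsto_finsetSum _ fun n hn =>
    (tendsto_vmean_coeff hG hB hc hσ fun h => hK (h ▸ hn)).const_mul _

theorem conj_mul_mul_self (z : ℂ) (r : ℝ) :
    conj z * (r : ℂ) * z = ((‖z‖ ^ 2 * r : ℝ) : ℂ) := by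
  rw [mul_right_comm, mul_comm (conj z), Complex.mul_conj, Complex.normSq_eq_norm_sq]
  push_cast
  ring

/-- Multiplication by a bounded Dirichlet series does not increase the mean square on a vertical
line by more than the factor `M²`. -/
theorem sum_sq_convolution_le {F : ℂ → ℂ} {b p : ℕ → ℂ} {M ρ σ : ℝ}
    (hF : DifferentiableOn ℂ F (Omega 0)) (hM : ∀ s ∈ Omega 0, ‖F s‖ ≤ M)
    (hb : ∀ s ∈ Omega ρ, LSeriesHasSum b s (F s)) {J K : Finset ℕ} (hJ : 0 ∉ J) (hK : 0 ∉ K)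
    (hp : ∀ n ∉ J, p n = 0) (hσ : 0 < σ) :
    ∑ n ∈ K, ‖LSeries.convolution b p n‖ ^ 2 * (n : ℝ) ^ (-2 * σ) ≤
      M ^ 2 * ∑ n ∈ J, ‖p n‖ ^ 2 * (n : ℝ) ^ (-2 * σ) := by
  set c := LSeries.convolution b p
  set P := dpoly p J
  set Q := dpoly c K
  set G : ℂ → ℂ := fun s => F s * P s
  have hM0 : 0 ≤ M := (norm_nonneg _).trans (hM 1 (by simp [Omega]))
  have hP : DifferentiableOn ℂ P (Omega 0) := (differentiable_dpoly p hJ).differentiableOn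
  have hQ : DifferentiableOn ℂ Q (Omega 0) := (differentiable_dpoly c hK).differentiableOn
  have hG : DifferentiableOn ℂ G (Omega 0) := hF.mul hP
  have hGB : ∀ s ∈ Omega 0, ‖G s‖ ≤ M * ∑ n ∈ J, ‖p n‖ := fun s hs => by
    rw [norm_mul]
    exact mul_le_mul (hM s hs) (norm_dpoly_le p hJ hs) (norm_nonneg _) hM0
  have hGc : ∀ s ∈ Omega ρ, LSeriesHasSum c s (G s) := fun s hs =>
    (hb s hs).convolution (lseriesHasSum_dpoly hJ hp s)
  have t1 := tendsto_vmean_mul_conj_dpoly hG hGB hGc hσ c hK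
  have t2 := tendsto_vmean_mul_conj_dpoly (ρ := ρ) hP (fun s hs => norm_dpoly_le p hJ hs)
    (fun s _ => lseriesHasSum_dpoly hJ hp s) hσ p hJ
  -- The actual coefficients of Q are c cut off to K. Thus Q paired with itself and G paired with Q
  -- have the same mean X.
  set c' : ℕ → ℂ := fun n => if n ∈ K then c n else 0
  have hQ' : dpoly c' K = Q := funext fun s => Finset.sum_congr rfl fun n hn => by simp [c', hn]
  have t3 := tendsto_vmean_mul_conj_dpoly (ρ := ρ) hQ (fun s hs => norm_dpoly_le c hK hs)
    (c := c') (fun s _ => hQ' ▸ lseriesHasSum_dpoly hK (fun n hn => by simp [c', hn]) s) hσ c hK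
  have e3 : ∑ n ∈ K, conj (c n) * (((n : ℝ) ^ (-2 * σ) : ℝ) : ℂ) * c' n =
      ∑ n ∈ K, conj (c n) * (((n : ℝ) ^ (-2 * σ) : ℝ) : ℂ) * c n :=
    Finset.sum_congr rfl fun n hn => by simp [c', hn]
  rw [e3] at t3
  simp only [conj_mul_mul_self, ← Complex.ofReal_sum] at t1 t2 t3
  set X := ∑ n ∈ K, ‖c n‖ ^ 2 * (n : ℝ) ^ (-2 * σ)
  set Y := ∑ n ∈ J, ‖p n‖ ^ 2 * (n : ℝ) ^ (-2 * σ)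
  have kP := continuous_vertical hP hσ
  have kQ := continuous_vertical hQ hσ
  have kG := continuous_vertical hG hσ
  have kPP : Continuous fun t : ℝ => P (σ + t * Complex.I) * conj (P (σ + t * Complex.I)) :=
    kP.mul (Complex.continuous_conj.comp kP)
  have kQQ : Continuous fun t : ℝ => Q (σ + t * Complex.I) * conj (Q (σ + t * Complex.I)) :=
    kQ.mul (Complex.continuous_conj.comp kQ)
  have kGQ : Continuous fun t : ℝ => G (σ + t * Complex.I) * conj (Q (σ + t * Complex.I)) :=
    kG.mul (Complex.continuous_conj.comp kQ)
  have kMP : Continuous fun t : ℝ =>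
      ((M ^ 2 : ℝ) : ℂ) * (P (σ + t * Complex.I) * conj (P (σ + t * Complex.I))) :=
    continuous_const.mul kPP
  have kS : Continuous fun t : ℝ =>
      ((M ^ 2 : ℝ) : ℂ) * (P (σ + t * Complex.I) * conj (P (σ + t * Complex.I))) +
        Q (σ + t * Complex.I) * conj (Q (σ + t * Complex.I)) := kMP.add kQQ
  have kMG : Continuous fun t : ℝ =>
      -2 * (G (σ + t * Complex.I) * conj (Q (σ + t * Complex.I))) :=
    continuous_const.mul kGQ
  -- The mean of M²|P|² + |Q|² - 2 G conj(Q). Its real part is nonnegative since |G| ≤ M|P| makes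
  -- the integrand at least (M|P| - |Q|)², and the limit is M²Y + X - 2X = M²Y - X.
  have t4 := ((t2.const_mul ((M ^ 2 : ℝ) : ℂ)).add t3).add (t1.const_mul (-2))
  have t5 := (Complex.continuous_re.tendsto _).comp t4
  have h6 : 0 ≤ (((M ^ 2 : ℝ) : ℂ) * (Y : ℂ) + (X : ℂ) + -2 * (X : ℂ)).re := by
    refine ge_of_tendsto t5 ?_
    filter_upwards [eventually_gt_atTop 0] with T hT
    simp only [Function.comp_apply, ← vmean_const_mul]
    rw [← vmean_add kMP kQQ, ← vmean_add kS kMG]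
    refine re_vmean_nonneg (kS.add kMG) (fun t => ?_) hT
    set s : ℂ := σ + t * Complex.I
    have hs : s ∈ Omega 0 := by simpa [Omega, s] using hσ
    have n1 : ‖G s‖ ≤ M * ‖P s‖ := by
      rw [norm_mul]
      exact mul_le_mul_of_nonneg_right (hM s hs) (norm_nonneg _)
    have n2 : (G s * conj (Q s)).re ≤ M * ‖P s‖ * ‖Q s‖ := by
      refine (Complex.re_le_norm _).trans ?_
      rw [norm_mul, RCLike.norm_conj]
      exact mul_le_mul_of_nonneg_right n1 (norm_nonneg _)
    have n3 : (((M ^ 2 : ℝ) : ℂ) * (P s * conj (P s)) + Q s * conj (Q s) +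
        -2 * (G s * conj (Q s))).re = M ^ 2 * ‖P s‖ ^ 2 + ‖Q s‖ ^ 2 -
          2 * (G s * conj (Q s)).re := by
      rw [Complex.mul_conj, Complex.mul_conj, Complex.normSq_eq_norm_sq,
        Complex.normSq_eq_norm_sq, Complex.add_re, Complex.add_re, Complex.re_ofReal_mul,
        Complex.ofReal_re, Complex.ofReal_re,
        show (-2 : ℂ) = ((-2 : ℝ) : ℂ) by push_cast; rfl, Complex.re_ofReal_mul]
      ring
    refine le_of_le_of_eq ?_ n3.symm
    nlinarith [sq_nonneg (M * ‖P s‖ - ‖Q s‖)]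
  have h7 : (((M ^ 2 : ℝ) : ℂ) * (Y : ℂ) + (X : ℂ) + -2 * (X : ℂ)).re = M ^ 2 * Y - X := by
    rw [show ((M ^ 2 : ℝ) : ℂ) * (Y : ℂ) + (X : ℂ) + -2 * (X : ℂ) = ((M ^ 2 * Y - X : ℝ) : ℂ) by
      push_cast; ring, Complex.ofReal_re]
  linarith [h7 ▸ h6]

/-! ### Weights given by measures -/

theorem measureWeight_coe (μ : Measure ℝ≥0) [IsProbabilityMeasure μ] (n : ℕ+) :
    (measureWeight μ n : ℝ) = ∫ σ, ((n : ℕ) : ℝ) ^ (-2 * (σ : ℝ)) ∂μ := rfl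

theorem integrable_weight (μ : Measure ℝ≥0) [IsProbabilityMeasure μ] {n : ℕ} (h : n ≠ 0) :
    Integrable (fun σ : ℝ≥0 => (n : ℝ) ^ (-2 * (σ : ℝ))) μ := by
  have hn : (1 : ℝ) ≤ n := by exact_mod_cast Nat.one_le_iff_ne_zero.2 h
  refine Integrable.of_bound (C := 1) (Measurable.aestronglyMeasurable (by fun_prop))
    (ae_of_all _ fun σ => ?_)
  rw [Real.norm_eq_abs, abs_of_pos (Real.rpow_pos_of_pos (by linarith) _)]
  exact Real.rpow_le_one_of_one_le_of_nonpos hn (by simp)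

/-- As 0 lies in the support, the set of σ with 2σ < ε has positive mass c, and there n^{-2σ} ≥
n^{-ε}. The support hypothesis enters the proof only through this bound. -/
theorem exists_rpow_le_measureWeight (μ : Measure ℝ≥0) [IsProbabilityMeasure μ]
    (hμ : 0 ∈ μ.support) {ε : ℝ} (hε : 0 < ε) :
    ∃ c > 0, ∀ n : ℕ+, c * ((n : ℕ) : ℝ) ^ (-ε) ≤ measureWeight μ n := by
  set S : Set ℝ≥0 := {σ | 2 * (σ : ℝ) < ε}
  have hS : IsOpen S := isOpen_lt (by fun_prop) continuous_const
  have hpos : 0 < μ S := (Measure.mem_support_iff_forall 0).1 hμ S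
    (hS.mem_nhds (by simpa [S] using hε))
  refine ⟨μ.real S, ENNReal.toReal_pos hpos.ne' (measure_ne_top _ _), fun n => ?_⟩
  have hn : (1 : ℝ) ≤ ((n : ℕ) : ℝ) := by exact_mod_cast n.pos
  rw [measureWeight_coe, ← smul_eq_mul, ← integral_indicator_const _ hS.measurableSet]
  refine integral_mono ((integrable_const _).indicator hS.measurableSet)
    (integrable_weight μ n.ne_zero) fun σ => ?_
  by_cases hσ : σ ∈ S
  · rw [Set.indicator_of_mem hσ]
    exact Real.rpow_le_rpow_of_exponent_le hn (by have : 2 * (σ : ℝ) < ε := hσ; linarith)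
  · rw [Set.indicator_of_notMem hσ]
    exact Real.rpow_nonneg (by linarith) _

theorem isAdmissible_half (μ : Measure ℝ≥0) [IsProbabilityMeasure μ] (hμ : 0 ∈ μ.support) :
    IsAdmissible (measureWeight μ) (1 / 2) := by
  refine ⟨by norm_num, fun σ hσ => ?_⟩
  -- With this ε the terms are at most a constant times n^{-(σ + 1/2)}, and σ + 1/2 > 1.
  obtain ⟨c, hc, h⟩ := exists_rpow_le_measureWeight μ hμ (ε := σ - 1 / 2) (by linarith)
  have h1 : Summable fun n : ℕ+ => c⁻¹ * ((n : ℕ) : ℝ) ^ (-(σ + 1 / 2)) :=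
    ((Real.summable_nat_rpow.2 (by linarith)).comp_injective PNat.coe_injective).mul_left _
  refine h1.of_nonneg_of_le (fun n => ?_) fun n => ?_
  · have := (measureWeight μ n).2
    positivity
  · have hn : (0 : ℝ) < ((n : ℕ) : ℝ) := by exact_mod_cast n.pos
    have h2 : 0 < c * ((n : ℕ) : ℝ) ^ (-(σ - 1 / 2)) := by positivity
    calc (measureWeight μ n : ℝ)⁻¹ * ((n : ℕ) : ℝ) ^ (-2 * σ)
        ≤ (c * ((n : ℕ) : ℝ) ^ (-(σ - 1 / 2)))⁻¹ * ((n : ℕ) : ℝ) ^ (-2 * σ) := by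
          gcongr
          exact h n
      _ = c⁻¹ * ((n : ℕ) : ℝ) ^ (-(σ + 1 / 2)) := by
          rw [mul_inv, ← Real.rpow_neg hn.le, mul_assoc, ← Real.rpow_add hn]
          congr 2
          ring

/-! ### Bounded Dirichlet series are multipliers -/

/-- The value σ = 0 is needed because μ may have an atom there; both sides are finite sums,
continuous in σ, so the inequality passes to the limit from the right. -/
theorem sum_sq_convolution_le_of_nonneg {F : ℂ → ℂ} {b p : ℕ → ℂ} {M ρ σ : ℝ}
    (hF : DifferentiableOn ℂ F (Omega 0)) (hM : ∀ s ∈ Omega 0, ‖F s‖ ≤ M)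
    (hb : ∀ s ∈ Omega ρ, LSeriesHasSum b s (F s)) {J K : Finset ℕ} (hJ : 0 ∉ J) (hK : 0 ∉ K)
    (hp : ∀ n ∉ J, p n = 0) (hσ : 0 ≤ σ) :
    ∑ n ∈ K, ‖LSeries.convolution b p n‖ ^ 2 * (n : ℝ) ^ (-2 * σ) ≤
      M ^ 2 * ∑ n ∈ J, ‖p n‖ ^ 2 * (n : ℝ) ^ (-2 * σ) := by
  have hcont (q : ℕ → ℂ) {I : Finset ℕ} (hI : 0 ∉ I) :
      Continuous fun x : ℝ => ∑ n ∈ I, ‖q n‖ ^ 2 * (n : ℝ) ^ (-2 * x) := by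
    refine continuous_finsetSum _ fun n hn => continuous_const.mul ?_
    have : (n : ℝ) ≠ 0 := by
      intro h
      exact hI (by rwa [Nat.cast_eq_zero.1 h] at hn)
    exact (Real.continuous_const_rpow this).comp (by fun_prop)
  refine le_of_tendsto_of_tendsto (b := 𝓝[>] σ)
    ((hcont _ hK).tendsto σ |>.mono_left nhdsWithin_le_nhds)
    (((hcont p hJ).const_mul (M ^ 2)).tendsto σ |>.mono_left nhdsWithin_le_nhds) ?_
  filter_upwards [self_mem_nhdsWithin] with x hx
  exact sum_sq_convolution_le hF hM hb hJ hK hp (hσ.trans_lt hx)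

/-- Integrating the inequality for n^{-2σ} against μ replaces these weights by w_n. -/
theorem sum_sq_dconv_le (μ : Measure ℝ≥0) [IsProbabilityMeasure μ] {F : ℂ → ℂ} {b : ℕ+ → ℂ}
    {M ρ : ℝ} (hF : DifferentiableOn ℂ F (Omega 0)) (hM : ∀ s ∈ Omega 0, ‖F s‖ ≤ M)
    (hb : ∀ s ∈ Omega ρ, LSeriesHasSum (extendNat b) s (F s)) (f : H (measureWeight μ))
    (K : Finset ℕ+) :
    ∑ n ∈ K, ‖dconv b f.coeff n‖ ^ 2 * (measureWeight μ n : ℝ) ≤ M ^ 2 * ‖f‖ ^ 2 := by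
  obtain ⟨N, hN⟩ := K.bddAbove
  -- The n-th coefficient of a convolution involves only divisors of n, so truncating f at an upper
  -- bound N of K leaves the sum over K unchanged and makes f a polynomial.
  set J : Finset ℕ+ := Finset.Icc 1 N
  set p : ℕ+ → ℂ := fun n => if n ∈ J then f.coeff n else 0
  set ι : ℕ+ ↪ ℕ := ⟨PNat.val, PNat.coe_injective⟩
  have h0 (I : Finset ℕ+) : 0 ∉ I.map ι := by
    simp only [Finset.mem_map, not_exists, not_and]
    exact fun n _ => n.ne_zero
  have hp : ∀ n ∉ J.map ι, extendNat p n = 0 := by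
    intro n hn
    rcases Nat.eq_zero_or_pos n with rfl | h
    · simp
    · lift n to ℕ+ using h
      have : n ∉ J := fun h => hn (Finset.mem_map_of_mem ι h)
      simp [p, this]
  have hconv : ∀ n ∈ K, dconv b p n = dconv b f.coeff n := by
    intro n hn
    rw [dconv_apply, dconv_apply]
    refine Finset.sum_congr rfl fun d hd => ?_
    obtain ⟨hd1, hd0⟩ := Nat.mem_divisorsAntidiagonal.1 hd
    have hpos : 0 < d.2 := Nat.pos_of_ne_zero fun h => hd0 (by rw [← hd1, h, mul_zero])
    have hle : d.2 ≤ n := Nat.le_of_dvd n.pos (Dvd.intro_left _ hd1)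
    generalize d.2 = m at hpos hle
    lift m to ℕ+ using hpos
    have hm : m ∈ J := Finset.mem_Icc.2 ⟨one_le, le_trans hle (hN hn)⟩
    simp [p, hm]
  have h1 (σ : ℝ≥0) : ∑ n ∈ K, ‖dconv b f.coeff n‖ ^ 2 * ((n : ℕ) : ℝ) ^ (-2 * (σ : ℝ)) ≤
      M ^ 2 * ∑ n ∈ J, ‖f.coeff n‖ ^ 2 * ((n : ℕ) : ℝ) ^ (-2 * (σ : ℝ)) := by
    have := sum_sq_convolution_le_of_nonneg hF hM hb (h0 J) (h0 K) hp σ.2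
    rw [Finset.sum_map, Finset.sum_map] at this
    refine le_of_eq_of_le (Finset.sum_congr rfl fun n hn => ?_) (this.trans_eq
      (congrArg (M ^ 2 * ·) (Finset.sum_congr rfl fun n hn => ?_)))
    · rw [← hconv n hn]
      rfl
    · simp [ι, p, hn]
  have hint (q : ℕ+ → ℂ) (n : ℕ+) :
      Integrable (fun σ : ℝ≥0 => ‖q n‖ ^ 2 * ((n : ℕ) : ℝ) ^ (-2 * (σ : ℝ))) μ :=
    (integrable_weight μ n.ne_zero).const_mul _
  have h2 (q : ℕ+ → ℂ) (I : Finset ℕ+) :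
      ∫ σ : ℝ≥0, ∑ n ∈ I, ‖q n‖ ^ 2 * ((n : ℕ) : ℝ) ^ (-2 * (σ : ℝ)) ∂μ =
        ∑ n ∈ I, ‖q n‖ ^ 2 * (measureWeight μ n : ℝ) := by
    rw [integral_finsetSum _ fun n _ => hint q n]
    exact Finset.sum_congr rfl fun n _ => integral_const_mul _ _
  have h3 := integral_mono (μ := μ) (integrable_finsetSum K fun n _ => hint _ n)
    ((integrable_finsetSum J fun n _ => hint _ n).const_mul _) h1
  rw [h2, integral_const_mul, h2] at h3
  refine h3.trans (mul_le_mul_of_nonneg_left ?_ (sq_nonneg M))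
  rw [H.norm_sq_eq]
  exact f.summable.sum_le_tsum _ fun n _ => mul_nonneg (sq_nonneg _) (measureWeight μ n).2.le

theorem dconv_add (a b c : ℕ+ → ℂ) (n : ℕ+) :
    dconv a (fun k => b k + c k) n = dconv a b n + dconv a c n := by
  have : extendNat (fun k => b k + c k) = fun k => extendNat b k + extendNat c k := by
    ext k
    rcases Nat.eq_zero_or_pos k with rfl | h
    · simp
    · lift k to ℕ+ using h
      simp
  simp only [dconv_apply, this, mul_add, Finset.sum_add_distrib]

theorem dconv_const_mul (a : ℕ+ → ℂ) (z : ℂ) (b : ℕ+ → ℂ) (n : ℕ+) :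
    dconv a (fun k => z * b k) n = z * dconv a b n := by
  have : extendNat (fun k => z * b k) = fun k => z * extendNat b k := by
    ext k
    rcases Nat.eq_zero_or_pos k with rfl | h
    · simp
    · lift k to ℕ+ using h
      simp
  simp only [dconv_apply, this, Finset.mul_sum, mul_left_comm]

/-- A bound for the Dirichlet convolution by `b` gives a bounded operator. -/
theorem exists_clm_of_sum_sq_dconv_le {w : Weight} {b : ℕ+ → ℂ} {M : ℝ} (hM : 0 ≤ M)
    (h : ∀ (f : H w) (K : Finset ℕ+),
      ∑ n ∈ K, ‖dconv b f.coeff n‖ ^ 2 * (w n : ℝ) ≤ M ^ 2 * ‖f‖ ^ 2) :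
    ∃ T : H w →L[ℂ] H w, (∀ f, (T f).coeff = dconv b f.coeff) ∧ ‖T‖ ≤ M := by
  have h0 (f : H w) (n : ℕ+) : 0 ≤ ‖dconv b f.coeff n‖ ^ 2 * (w n : ℝ) :=
    mul_nonneg (sq_nonneg _) (w n).2.le
  let L : H w →ₗ[ℂ] H w :=
    { toFun f := ⟨dconv b f.coeff, summable_of_sum_le (h0 f) (h f)⟩
      map_add' f g := H.ext fun n => dconv_add b f.coeff g.coeff n
      map_smul' z f := H.ext fun n => dconv_const_mul b z f.coeff n }
  refine ⟨L.mkContinuous M fun f => ?_, fun f => rfl, L.mkContinuous_norm_le hM _⟩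
  rw [← sq_le_sq₀ (norm_nonneg _) (mul_nonneg hM (norm_nonneg _)), H.norm_sq_eq, mul_pow]
  exact (summable_of_sum_le (h0 f) (h f)).tsum_le_of_sum_le (h f)

/-- Convergence at one point bounds the terms there, hence gives absolute convergence more than one
unit to the right; this is why the half-plane shrinks. -/
theorem IsDirichletRepresentable.exists_lseriesHasSum {φ : Omega 0 → ℂ}
    (h : IsDirichletRepresentable φ) :
    ∃ ρ : ℝ, 0 ≤ ρ ∧ ∃ a : ℕ+ → ℂ, ∀ s : Omega 0, (s : ℂ) ∈ Omega ρ →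
      LSeriesHasSum (extendNat a) s (φ s) := by
  obtain ⟨σ, a, ha⟩ := h
  set ρ : ℝ := max σ 0 + 1
  have h1 : σ < ρ := by have := le_max_left σ 0; linarith
  have h2 : 0 < ρ := by have := le_max_right σ 0; linarith
  refine ⟨ρ + 1, by linarith, a, fun s hs => ?_⟩
  have hs' : ρ + 1 < (s : ℂ).re := hs
  exact (ha ⟨ρ, by simpa [Omega] using h2⟩ (by simpa using h1)).lseries (Complex.ofReal_re ρ) hs
    (ha s (by linarith))

theorem H.differentiableOn_eval {w : Weight} {σ₀ : ℝ} (hσ : IsAdmissible w σ₀) (f : H w) :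
    DifferentiableOn ℂ f.eval (Omega σ₀) :=
  (differentiableOn_LSeries_omega fun _ => f.lseriesSummable hσ).congr fun s _ =>
    f.eval_eq_LSeries s

/-- A function in `H^∞(Ω_0) ∩ 𝒟` defines a bounded multiplication operator, of norm at most its
supremum norm. -/
theorem exists_mulOperator_of_mem_hInfDirichlet (μ : Measure ℝ≥0) [IsProbabilityMeasure μ]
    {σ₀ : ℝ} (hσ : IsAdmissible (measureWeight μ) σ₀) {ψ : Omega 0 →ᵇ ℂ}
    (hψ : ψ ∈ hInfDirichlet) :
    ∃ T : H (measureWeight μ) →L[ℂ] H (measureWeight μ), ‖T‖ ≤ ‖ψ‖ ∧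
      ∀ (f : H (measureWeight μ)) (s : Omega 0), (s : ℂ) ∈ Omega σ₀ →
        (T f).eval s = ψ s * f.eval s := by
  obtain ⟨⟨F, hF, hFψ⟩, hD⟩ := hψ
  obtain ⟨ρ, hρ, b, hb⟩ := hD.exists_lseriesHasSum
  have hM : ∀ s ∈ Omega 0, ‖F s‖ ≤ ‖ψ‖ := fun s hs => by
    rw [show F s = ψ ⟨s, hs⟩ from hFψ ⟨s, hs⟩]
    exact ψ.norm_coe_le_norm _
  have hb' : ∀ s ∈ Omega ρ, LSeriesHasSum (extendNat b) s (F s) := fun s hs => by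
    rw [show F s = ψ ⟨s, omega_subset hρ hs⟩ from hFψ ⟨s, omega_subset hρ hs⟩]
    exact hb ⟨s, omega_subset hρ hs⟩ hs
  obtain ⟨T, hT, hTn⟩ := exists_clm_of_sum_sq_dconv_le (norm_nonneg ψ)
    (sum_sq_dconv_le μ hF hM hb')
  refine ⟨T, hTn, fun f s hs => ?_⟩
  rw [← hFψ s]
  -- The product of series is legitimate only where both converge absolutely, and ρ may exceed σ₀;
  -- analytic uniqueness carries the identity back to `Omega σ₀`.
  refine eqOn_omega_of_eqOn (ε := max ρ σ₀) ((T f).differentiableOn_eval hσ)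
    ((hF.mono (omega_subset hσ.1.le)).mul (f.differentiableOn_eval hσ)) (fun z hz => ?_) hs
  have h1 := (hb' z (omega_subset (le_max_left _ _) hz)).convolution
    (f.lseriesSummable hσ (omega_subset (le_max_right _ _) hz)).LSeriesHasSum
  rw [← extendNat_dconv, ← hT f] at h1
  rw [H.eval_eq_LSeries, h1.LSeries_eq, ← H.eval_eq_LSeries]
  rfl

/-! ### Multipliers define bounded operators -/

/-- Square-summability against the inverse weights gives a bounded functional. -/
theorem exists_clm_of_summable {w : Weight} {u : ℕ+ → ℂ}
    (hu : Summable fun n => (w n : ℝ)⁻¹ * ‖u n‖ ^ 2) :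
    ∃ l : H w →L[ℂ] ℂ, ∀ f : H w, HasSum (fun n => f.coeff n * u n) (l f) := by
  have hg : Summable fun n => ‖((w n : ℝ) : ℂ)⁻¹ * conj (u n)‖ ^ 2 * (w n : ℝ) := by
    refine hu.congr fun n => ?_
    have hw := (w n).2
    rw [norm_mul, norm_inv, Complex.norm_real, Real.norm_eq_abs, abs_of_pos hw, RCLike.norm_conj]
    field_simp
  -- The Riesz representative of f ↦ ∑ a_n u_n for the weighted inner product.
  let g : H w := ⟨fun n => ((w n : ℝ) : ℂ)⁻¹ * conj (u n), hg⟩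
  refine ⟨innerSL ℂ g, fun f => ?_⟩
  have h1 := (H.summable_inner g f).hasSum
  refine h1.congr_fun fun n => ?_
  have hw : ((w n : ℝ) : ℂ) ≠ 0 := by exact_mod_cast (w n).2.ne'
  have h2 : g.coeff n = ((w n : ℝ) : ℂ)⁻¹ * conj (u n) := rfl
  rw [h2, map_mul, map_inv₀, Complex.conj_conj, Complex.conj_ofReal]
  field_simp

theorem norm_cpow_neg_sq (n : ℕ+) (s : ℂ) :
    ‖((n : ℕ) : ℂ) ^ (-s)‖ ^ 2 = ((n : ℕ) : ℝ) ^ (-2 * s.re) := by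
  rw [Complex.norm_natCast_cpow_of_pos n.pos, ← Real.rpow_natCast, ← Real.rpow_mul (by positivity)]
  congr 1
  simp
  ring

theorem H.exists_clm_eval {w : Weight} {σ₀ : ℝ} (hσ : IsAdmissible w σ₀) {s : ℂ}
    (hs : s ∈ Omega σ₀) : ∃ l : H w →L[ℂ] ℂ, ∀ f : H w, l f = f.eval s := by
  obtain ⟨l, hl⟩ := exists_clm_of_summable (w := w) (u := fun n => ((n : ℕ) : ℂ) ^ (-s))
    ((hσ.2 _ hs).congr fun n => by rw [norm_cpow_neg_sq])
  exact ⟨l, fun f => (hl f).tsum_eq.symm⟩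

theorem H.eval_add {w : Weight} {σ₀ : ℝ} (hσ : IsAdmissible w σ₀) (f g : H w) {s : ℂ}
    (hs : s ∈ Omega σ₀) : (f + g).eval s = f.eval s + g.eval s := by
  obtain ⟨l, hl⟩ := H.exists_clm_eval hσ hs
  rw [← hl, ← hl, ← hl, map_add]

theorem H.eval_smul {w : Weight} {σ₀ : ℝ} (hσ : IsAdmissible w σ₀) (c : ℂ) (f : H w) {s : ℂ}
    (hs : s ∈ Omega σ₀) : (c • f).eval s = c * f.eval s := by
  obtain ⟨l, hl⟩ := H.exists_clm_eval hσ hs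
  rw [← hl, ← hl, map_smul, smul_eq_mul]

/-- Closed graph theorem: point evaluations on `Omega σ₀` are continuous and separate elements of `H
w`, so they identify any limit of φ u_n with φ times the limit of u_n. -/
theorem IsMultiplier.exists_isMulOperator {w : Weight} {σ₀ : ℝ} (hσ : IsAdmissible w σ₀)
    {φ : ℂ → ℂ} (h : IsMultiplier w σ₀ φ) : ∃ T : H w →L[ℂ] H w, IsMulOperator w σ₀ φ T := by
  choose T hT using h
  let L : H w →ₗ[ℂ] H w :=
    { toFun := T
      map_add' f g := H.ext_eval hσ fun s hs => by
        rw [H.eval_add hσ _ _ hs, hT _ s hs, hT _ s hs, hT _ s hs, H.eval_add hσ _ _ hs, mul_add]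
      map_smul' c f := H.ext_eval hσ fun s hs => by
        rw [RingHom.id_apply, H.eval_smul hσ _ _ hs, hT _ s hs, hT _ s hs, H.eval_smul hσ _ _ hs,
          mul_left_comm] }
  have hL : Continuous L := L.continuous_of_seq_closed_graph fun u x y hu hy => by
    refine H.ext_eval hσ fun s hs => ?_
    obtain ⟨l, hl⟩ := H.exists_clm_eval hσ hs
    have h1 := (l.continuous.tendsto y).comp hy
    have h2 := ((l.continuous.tendsto x).comp hu).const_mul (φ s)
    rw [← hl, show (L x).eval s = φ s * x.eval s from hT x s hs, ← hl]
    refine tendsto_nhds_unique h1 (h2.congr fun n => ?_)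
    simp only [Function.comp_apply, hl]
    exact (hT (u n) s hs).symm
  exact ⟨⟨L, hL⟩, hT⟩

/-! ### Limits of bounded holomorphic functions -/

/-- Cauchy's estimate bounds all derivatives near x by M/r, giving a common Lipschitz constant. The
radius r is a third of that of a ball inside U, so that discs of radius r about points of the r-ball
stay in U. -/
theorem equicontinuousAt_of_norm_le {ι : Type*} {F : ι → ℂ → ℂ} {U : Set ℂ} {M : ℝ}
    (hU : IsOpen U) (hF : ∀ i, DifferentiableOn ℂ (F i) U) (hM : ∀ i, ∀ s ∈ U, ‖F i s‖ ≤ M)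
    {x : ℂ} (hx : x ∈ U) : EquicontinuousAt F x := by
  obtain ⟨ε, hε, hball⟩ := Metric.isOpen_iff.1 hU x hx
  set r := ε / 3
  have hr : 0 < r := by positivity
  have hsub {y : ℂ} (hy : y ∈ Metric.ball x r) : Metric.closedBall y r ⊆ U := fun z hz => by
    refine hball ?_
    have h1 := dist_triangle z y x
    rw [Metric.mem_ball] at hy ⊢
    rw [Metric.mem_closedBall] at hz
    have : ε = 3 * r := by simp only [r]; ring
    linarith
  refine Metric.equicontinuousAt_of_continuity_modulus (fun y => M / r * dist y x) ?_ F ?_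
  · have : Continuous fun y => M / r * dist y x := by fun_prop
    simpa using this.tendsto x
  · filter_upwards [Metric.ball_mem_nhds x hr] with y hy i
    rw [dist_comm (F i x), dist_eq_norm, dist_eq_norm]
    refine Convex.norm_image_sub_le_of_norm_deriv_le (s := Metric.ball x r) (fun z hz => ?_)
      (fun z hz => ?_) (convex_ball x r) (Metric.mem_ball_self hr) hy
    · exact (hF i).differentiableAt
        (hU.mem_nhds (hsub hz (Metric.mem_closedBall_self hr.le)))
    · refine Complex.norm_deriv_le_of_forall_mem_sphere_norm_le hr ?_ fun v hv =>
        hM i v (hsub hz (Metric.sphere_subset_closedBall hv))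
      exact ((hF i).mono (hsub hz)).diffContOnCl_ball (Set.Subset.refl _)

/-- A pointwise limit of uniformly bounded holomorphic functions is holomorphic. -/
theorem differentiableOn_of_tendsto_of_norm_le {ι : Type*} {l : Filter ι} [l.NeBot]
    {F : ι → ℂ → ℂ} {f : ℂ → ℂ} {U : Set ℂ} {M : ℝ} (hU : IsOpen U)
    (hF : ∀ i, DifferentiableOn ℂ (F i) U) (hM : ∀ i, ∀ s ∈ U, ‖F i s‖ ≤ M)
    (hf : ∀ s ∈ U, Tendsto (fun i => F i s) l (𝓝 (f s))) : DifferentiableOn ℂ f U := by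
  refine TendstoLocallyUniformlyOn.differentiableOn (φ := l) (F := F) ?_
    (Eventually.of_forall hF) hU
  rw [tendstoLocallyUniformlyOn_iff_forall_isCompact hU]
  intro K hKU hK
  -- For an equicontinuous family, pointwise convergence on a compact set is uniform.
  have h1 := EquicontinuousOn.tendsto_uniformOnFun_iff_pi' (𝔖 := {K}) (F := F)
    (by simpa using hK)
    (by
      rintro _ rfl x hx
      exact (equicontinuousAt_of_norm_le hU hF hM (hKU hx)).equicontinuousWithinAt _)
    l f
  have h2 := h1.2 (tendsto_pi_nhds.2 fun x => hf x (hKU (by simpa using x.2)))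
  rw [UniformOnFun.tendsto_iff_tendstoUniformlyOn] at h2
  exact h2 K rfl

/-- If uniformly bounded holomorphic functions on `U` converge pointwise on `V ⊆ U`, then the limit
extends from `V` to a holomorphic function on `U` with the same bound. -/
theorem exists_differentiableOn_extension {ι : Type*} {l : Filter ι} [l.NeBot]
    {F : ι → ℂ → ℂ} {g : ℂ → ℂ} {U V : Set ℂ} {M : ℝ} (hU : IsOpen U) (hVU : V ⊆ U)
    (hF : ∀ i, DifferentiableOn ℂ (F i) U) (hM : ∀ i, ∀ s ∈ U, ‖F i s‖ ≤ M)
    (hg : ∀ s ∈ V, Tendsto (fun i => F i s) l (𝓝 (g s))) :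
    ∃ f : ℂ → ℂ, DifferentiableOn ℂ f U ∧ (∀ s ∈ U, ‖f s‖ ≤ M) ∧ ∀ s ∈ V, f s = g s := by
  -- Along an ultrafilter every bounded family of values converges, which replaces extracting a
  -- subsequence as in Montel's theorem. Being finer than l, it keeps the prescribed limits on V.
  let u := Ultrafilter.of l
  have h1 (s : ℂ) : ∃ z, s ∈ U → ‖z‖ ≤ M ∧ Tendsto (fun i => F i s) u (𝓝 z) := by
    by_cases hs : s ∈ U
    · obtain ⟨z, hz, hz'⟩ := (isCompact_closedBall (0 : ℂ) M).ultrafilter_le_nhds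
        (u.map fun i => F i s)
        (le_principal_iff.2 (Filter.mem_map.2 (Filter.univ_mem' fun i => by
          simpa using hM i s hs)))
      exact ⟨z, fun _ => ⟨by simpa using hz, hz'⟩⟩
    · exact ⟨0, fun h => absurd h hs⟩
  choose f hf using h1
  refine ⟨f, differentiableOn_of_tendsto_of_norm_le (l := (u : Filter ι)) hU hF hM
    fun s hs => (hf s hs).2, fun s hs => (hf s hs).1, fun s hs => ?_⟩
  exact tendsto_nhds_unique (hf s (hVU hs)).2 ((hg s hs).mono_left (Ultrafilter.of_le l))

/-! ### Restriction to smooth numbers -/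

/-- The coefficients `a_n` for `N`-smooth `n`, and `0` for the other `n`. -/
noncomputable def smoothPart (N : ℕ) (a : ℕ+ → ℂ) : ℕ+ → ℂ :=
  {n : ℕ+ | (n : ℕ) ∈ N.smoothNumbers}.indicator a

theorem extendNat_smoothPart (N : ℕ) (a : ℕ+ → ℂ) :
    extendNat (smoothPart N a) = N.smoothNumbers.indicator (extendNat a) := by
  ext n
  rcases Nat.eq_zero_or_pos n with rfl | h
  · rw [extendNat_zero, Set.indicator_of_notMem]
    exact fun h => Nat.ne_zero_of_mem_smoothNumbers h rfl
  · lift n to ℕ+ using h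
    rw [extendNat_coe]
    by_cases hn : (n : ℕ) ∈ N.smoothNumbers
    · rw [Set.indicator_of_mem hn, extendNat_coe]
      exact Set.indicator_of_mem (s := {n : ℕ+ | (n : ℕ) ∈ N.smoothNumbers}) hn _
    · rw [Set.indicator_of_notMem hn]
      exact Set.indicator_of_notMem (s := {n : ℕ+ | (n : ℕ) ∈ N.smoothNumbers}) hn _

/-- A product is N-smooth exactly when both factors are, so restriction to smooth numbers is
multiplicative for convolution. -/
theorem dconv_smoothPart (N : ℕ) (a b : ℕ+ → ℂ) :
    dconv (smoothPart N a) (smoothPart N b) = smoothPart N (dconv a b) := by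
  ext n
  rw [dconv_apply, extendNat_smoothPart, extendNat_smoothPart]
  by_cases hn : (n : ℕ) ∈ N.smoothNumbers
  · rw [smoothPart, Set.indicator_of_mem (s := {n : ℕ+ | (n : ℕ) ∈ N.smoothNumbers}) hn,
      dconv_apply]
    refine Finset.sum_congr rfl fun d hd => ?_
    have hd' := (Nat.mem_divisorsAntidiagonal.1 hd).1
    rw [Set.indicator_of_mem (Nat.mem_smoothNumbers_of_dvd hn (Dvd.intro _ hd')),
      Set.indicator_of_mem (Nat.mem_smoothNumbers_of_dvd hn (Dvd.intro_left _ hd'))]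
  · rw [smoothPart, Set.indicator_of_notMem (s := {n : ℕ+ | (n : ℕ) ∈ N.smoothNumbers}) hn]
    refine Finset.sum_eq_zero fun d hd => ?_
    have hd' := (Nat.mem_divisorsAntidiagonal.1 hd).1
    by_cases h1 : d.1 ∈ N.smoothNumbers
    · by_cases h2 : d.2 ∈ N.smoothNumbers
      · exact absurd (hd' ▸ Nat.mul_mem_smoothNumbers h1 h2) hn
      · rw [Set.indicator_of_notMem h2, mul_zero]
    · rw [Set.indicator_of_notMem h1, zero_mul]

/-- Only the finitely many primes below N occur, so the sum is a finite product of convergent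
geometric series; hence any x > 0 suffices. -/
theorem summable_smoothNumbers_rpow (N : ℕ) {x : ℝ} (hx : 0 < x) :
    Summable (N.smoothNumbers.indicator fun n : ℕ => (n : ℝ) ^ (-x)) := by
  let f : ℕ →* ℝ :=
    { toFun n := (n : ℝ) ^ (-x)
      map_one' := by simp
      map_mul' m n := by rw [Nat.cast_mul, Real.mul_rpow m.cast_nonneg n.cast_nonneg] }
  have h := (EulerProduct.summable_and_hasSum_smoothNumbers_prod_primesBelow_geometric (f := f)
    (fun {p} hp => by
      have h1 : (1 : ℝ) < p := by exact_mod_cast hp.one_lt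
      change ‖(p : ℝ) ^ (-x)‖ < 1
      rw [Real.norm_eq_abs, abs_of_nonneg (by positivity)]
      exact Real.rpow_lt_one_of_one_lt_of_neg h1 (by linarith)) N).2.summable
  exact summable_subtype_iff_indicator.1 h

/-- Half of the decay n^{-2 Re s} is spent on the lower bound for w_n with ε = Re s; the remaining
n^{-Re s} is summable over smooth numbers. -/
theorem summable_smoothPart_cpow (μ : Measure ℝ≥0) [IsProbabilityMeasure μ] (hμ : 0 ∈ μ.support)
    (N : ℕ) {s : ℂ} (hs : s ∈ Omega 0) :
    Summable fun n => (measureWeight μ n : ℝ)⁻¹ *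
      ‖smoothPart N (fun k => ((k : ℕ) : ℂ) ^ (-s)) n‖ ^ 2 := by
  have hs' : 0 < s.re := hs
  obtain ⟨c, hc, h⟩ := exists_rpow_le_measureWeight μ hμ hs'
  have h1 := ((summable_smoothNumbers_rpow N hs').comp_injective
    PNat.coe_injective).mul_left c⁻¹
  refine h1.of_nonneg_of_le (fun n => ?_) fun n => ?_
  · have := (measureWeight μ n).2
    positivity
  · have hn : (0 : ℝ) < ((n : ℕ) : ℝ) := by exact_mod_cast n.pos
    by_cases hN : (n : ℕ) ∈ N.smoothNumbers
    · rw [smoothPart, Set.indicator_of_mem (s := {n : ℕ+ | (n : ℕ) ∈ N.smoothNumbers}) hN,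
        Function.comp_apply, Set.indicator_of_mem hN, norm_cpow_neg_sq]
      have h2 : 0 < c * ((n : ℕ) : ℝ) ^ (-s.re) := by positivity
      calc (measureWeight μ n : ℝ)⁻¹ * ((n : ℕ) : ℝ) ^ (-2 * s.re)
          ≤ (c * ((n : ℕ) : ℝ) ^ (-s.re))⁻¹ * ((n : ℕ) : ℝ) ^ (-2 * s.re) := by
            gcongr
            exact h n
        _ = c⁻¹ * ((n : ℕ) : ℝ) ^ (-s.re) := by
            rw [mul_inv, ← Real.rpow_neg hn.le, mul_assoc, ← Real.rpow_add hn]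
            congr 2
            ring
    · rw [smoothPart, Set.indicator_of_notMem (s := {n : ℕ+ | (n : ℕ) ∈ N.smoothNumbers}) hN,
        Function.comp_apply, Set.indicator_of_notMem hN]
      simp

/-- The value at `s ∈ Ω_0` of the smooth part of `f ∈ H^w` depends continuously on `f`. -/
theorem exists_clm_smoothPart (μ : Measure ℝ≥0) [IsProbabilityMeasure μ] (hμ : 0 ∈ μ.support)
    (N : ℕ) {s : ℂ} (hs : s ∈ Omega 0) :
    ∃ l : H (measureWeight μ) →L[ℂ] ℂ, ∀ f : H (measureWeight μ),
      LSeriesHasSum (extendNat (smoothPart N f.coeff)) s (l f) := by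
  obtain ⟨l, hl⟩ := exists_clm_of_summable (summable_smoothPart_cpow μ hμ N hs)
  refine ⟨l, fun f => hasSum_dterm_iff.1 ((hl f).congr_fun fun n => ?_)⟩
  simp only [dterm, smoothPart, Set.indicator_apply]
  split_ifs
  · rfl
  · rw [zero_mul, mul_zero]

/-- If `T` is the Dirichlet convolution by `T 1`, then the smooth parts of `T 1` are bounded by
`‖T‖` on `Ω_0`. -/
theorem norm_LSeries_smoothPart_le (μ : Measure ℝ≥0) [IsProbabilityMeasure μ]
    (hμ : 0 ∈ μ.support) {T : H (measureWeight μ) →L[ℂ] H (measureWeight μ)}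
    (hT : ∀ f, (T f).coeff = dconv (T (H.one _)).coeff f.coeff) (N : ℕ) {s : ℂ}
    (hs : s ∈ Omega 0) :
    ‖LSeries (extendNat (smoothPart N (T (H.one _)).coeff)) s‖ ≤ ‖T‖ := by
  obtain ⟨l, hl⟩ := exists_clm_smoothPart μ hμ N hs
  set x := l (T (H.one _))
  -- Restricted evaluation is multiplicative on convolutions, hence an eigenvector of the adjoint of
  -- T; the eigenvalue is bounded by ‖T‖ once l ≠ 0, which l(1) = 1 provides.
  have h1 : l.comp T = x • l := by
    ext f
    have h2 := (hl (T (H.one _))).convolution (hl f)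
    rw [← extendNat_dconv, dconv_smoothPart, ← hT f] at h2
    exact (hl (T f)).unique h2
  have h3 : l (H.one _) = 1 := by
    have h4 := hasSum_dterm_iff.2 (hl (H.one _))
    rw [← h4.tsum_eq, tsum_eq_single 1]
    · have : ((1 : ℕ+) : ℕ) ∈ N.smoothNumbers := by simp [Nat.mem_smoothNumbers]
      rw [dterm, smoothPart, Set.indicator_of_mem (s := {n : ℕ+ | (n : ℕ) ∈ N.smoothNumbers}) this]
      simp [H.one, H.coeff, oneCoeff]
    · intro n hn
      simp [dterm, smoothPart, Set.indicator_apply, H.one, H.coeff, oneCoeff, hn]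
  have h5 : 0 < ‖l‖ := by
    refine (norm_nonneg l).lt_of_ne fun h => ?_
    have h7 := l.le_opNorm (H.one _)
    rw [h3, ← h, zero_mul, norm_one] at h7
    exact absurd h7 (by norm_num)
  have h6 := l.opNorm_comp_le T
  rw [h1, norm_smul, mul_comm] at h6
  rw [(hl (T (H.one _))).LSeries_eq]
  exact le_of_mul_le_mul_left h6 h5

/-- Each n is N-smooth once N > n, and the full absolutely convergent series dominates. -/
theorem tendsto_LSeries_smoothPart {a : ℕ+ → ℂ} {s : ℂ} (ha : LSeriesSummable (extendNat a) s) :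
    Tendsto (fun N => LSeries (extendNat (smoothPart N a)) s) atTop
      (𝓝 (LSeries (extendNat a) s)) := by
  simp only [← tsum_dterm]
  refine tendsto_tsum_of_dominated_convergence (summable_dterm_iff.2 ha).norm (fun n => ?_)
    (Eventually.of_forall fun N n => ?_)
  · refine tendsto_const_nhds.congr' ?_
    filter_upwards [eventually_gt_atTop (n : ℕ)] with N hN
    rw [dterm, dterm, smoothPart, Set.indicator_of_mem
      (s := {n : ℕ+ | (n : ℕ) ∈ N.smoothNumbers}) (Nat.mem_smoothNumbers_of_lt n.pos hN)]
  · rw [dterm, dterm, norm_mul, norm_mul]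
    gcongr
    exact norm_indicator_le_norm_self _ _

/-- Since 1 belongs to `H w`, the symbol φ is itself the Dirichlet series T 1 on `Omega σ₀`, so T f
is a product of two series there and uniqueness of coefficients applies. -/
theorem IsMulOperator.coeff_eq_dconv {w : Weight} {σ₀ : ℝ} (hσ : IsAdmissible w σ₀) {φ : ℂ → ℂ}
    {T : H w →L[ℂ] H w} (hT : IsMulOperator w σ₀ φ T) (f : H w) :
    (T f).coeff = dconv (T (H.one w)).coeff f.coeff := by
  have h1 (s : ℂ) (hs : s ∈ Omega σ₀) := ((T (H.one w)).lseriesSummable hσ hs).LSeriesHasSum.convolution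
    (f.lseriesSummable hσ hs).LSeriesHasSum
  ext n
  have h2 := eq_of_LSeries_eqOn (fun s hs => (T f).lseriesSummable hσ hs)
    (fun s hs => (h1 s hs).LSeriesSummable) (fun s hs => ?_) n.ne_zero
  · rw [extendNat_coe] at h2
    exact h2
  · rw [(h1 s hs).LSeries_eq, ← H.eval_eq_LSeries, ← H.eval_eq_LSeries, ← H.eval_eq_LSeries,
      hT f s hs, hT _ s hs, H.eval_one, mul_one]

/-- A multiplier extends to a function in `H^∞(Ω_0) ∩ 𝒟`, bounded by the operator norm. -/
theorem exists_mem_hInfDirichlet_of_isMulOperator (μ : Measure ℝ≥0) [IsProbabilityMeasure μ]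
    (hμ : 0 ∈ μ.support) {σ₀ : ℝ} (hσ : IsAdmissible (measureWeight μ) σ₀) {φ : ℂ → ℂ}
    {T : H (measureWeight μ) →L[ℂ] H (measureWeight μ)}
    (hT : IsMulOperator (measureWeight μ) σ₀ φ T) :
    ∃ ψ ∈ hInfDirichlet, ‖ψ‖ ≤ ‖T‖ ∧
      ∀ (f : H (measureWeight μ)) (s : Omega 0), (s : ℂ) ∈ Omega σ₀ →
        (T f).eval s = ψ s * f.eval s := by
  set b := (T (H.one _)).coeff
  obtain ⟨F, hF, hFM, hFb⟩ := exists_differentiableOn_extension (l := atTop) (U := Omega 0)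
    (V := Omega σ₀) (F := fun N => LSeries (extendNat (smoothPart N b)))
    (g := LSeries (extendNat b)) (M := ‖T‖) (isOpen_omega 0) (omega_subset hσ.1.le)
    (fun N => differentiableOn_LSeries_omega fun s hs => by
      obtain ⟨l, hl⟩ := exists_clm_smoothPart μ hμ N hs
      exact (hl _).LSeriesSummable)
    (fun N s hs => norm_LSeries_smoothPart_le μ hμ (hT.coeff_eq_dconv hσ) N hs)
    (fun s hs => tendsto_LSeries_smoothPart ((T (H.one _)).lseriesSummable hσ hs))
  let ψ : Omega 0 →ᵇ ℂ := BoundedContinuousFunction.ofNormedAddCommGroup (fun s => F s)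
    (continuousOn_iff_continuous_domRestrict.1 hF.continuousOn) ‖T‖ fun s => hFM s s.2
  have hψ (s : Omega 0) (hs : (s : ℂ) ∈ Omega σ₀) : ψ s = (T (H.one _)).eval s := by
    rw [H.eval_eq_LSeries, ← hFb s hs]
    rfl
  refine ⟨ψ, ⟨⟨F, hF, fun s => rfl⟩, σ₀, b, fun s hs => ?_⟩,
    BoundedContinuousFunction.norm_ofNormedAddCommGroup_le _ (norm_nonneg _) _, fun f s hs => ?_⟩
  · have h1 := HasDirichletSum.of_lseries _
      ((T (H.one _)).lseriesSummable hσ hs).LSeriesHasSum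
    simp only [extendNat_coe] at h1
    rw [hψ s hs, H.eval_eq_LSeries]
    exact h1
  · rw [hψ s hs, hT f s hs, hT _ s hs, H.eval_one, mul_one]

/-! ### The multiplier algebra -/

/-- `T` is the operator of multiplication by `ψ` on `Ω_{σ₀}`. -/
def IsMulBy {w : Weight} (σ₀ : ℝ) (T : H w →L[ℂ] H w) (ψ : Omega 0 →ᵇ ℂ) : Prop :=
  ∀ (f : H w) (s : Omega 0), (s : ℂ) ∈ Omega σ₀ → (T f).eval s = ψ s * f.eval s

theorem IsMulBy.operator_ext {w : Weight} {σ₀ : ℝ} (hσ : IsAdmissible w σ₀) {S T : H w →L[ℂ] H w}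
    {ψ : Omega 0 →ᵇ ℂ} (hS : IsMulBy σ₀ S ψ) (hT : IsMulBy σ₀ T ψ) : S = T := by
  refine ContinuousLinearMap.ext fun f => H.ext_eval hσ fun s hs => ?_
  exact (hS f ⟨s, omega_subset hσ.1.le hs⟩ hs).trans (hT f ⟨s, omega_subset hσ.1.le hs⟩ hs).symm

/-- Testing on f = 1 recovers the symbol on `Omega σ₀`, and analytic continuation recovers it on
`Omega 0`. This uniqueness yields all the algebra homomorphism laws. -/
theorem IsMulBy.symbol_ext {w : Weight} {σ₀ : ℝ} (hσ : IsAdmissible w σ₀) {T : H w →L[ℂ] H w}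
    {ψ χ : hInfDirichlet} (hψ : IsMulBy σ₀ T ψ) (hχ : IsMulBy σ₀ T χ) : ψ = χ := by
  obtain ⟨F, hF, hFψ⟩ := ψ.2.1
  obtain ⟨G, hG, hGχ⟩ := χ.2.1
  refine Subtype.ext (BoundedContinuousFunction.ext fun s => ?_)
  rw [← hFψ, ← hGχ]
  refine eqOn_omega_of_eqOn (ε := σ₀) hF hG (fun z hz => ?_) s.2
  have h0 := omega_subset hσ.1.le hz
  have h1 := (hψ (H.one w) ⟨z, h0⟩ hz).symm.trans (hχ (H.one w) ⟨z, h0⟩ hz)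
  rw [H.eval_one, mul_one, mul_one, ← hFψ, ← hGχ] at h1
  exact h1

theorem IsMulBy.add {w : Weight} {σ₀ : ℝ} (hσ : IsAdmissible w σ₀) {S T : H w →L[ℂ] H w}
    {ψ χ : Omega 0 →ᵇ ℂ} (hS : IsMulBy σ₀ S ψ) (hT : IsMulBy σ₀ T χ) :
    IsMulBy σ₀ (S + T) (ψ + χ) := fun f s hs => by
  rw [add_apply, H.eval_add hσ _ _ hs, hS f s hs, hT f s hs,
    BoundedContinuousFunction.add_apply, add_mul]

theorem IsMulBy.mul {w : Weight} {σ₀ : ℝ} {S T : H w →L[ℂ] H w} {ψ χ : Omega 0 →ᵇ ℂ}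
    (hS : IsMulBy σ₀ S ψ) (hT : IsMulBy σ₀ T χ) : IsMulBy σ₀ (S * T) (ψ * χ) := fun f s hs => by
  rw [mul_apply_eq_comp, hS _ s hs, hT f s hs, BoundedContinuousFunction.mul_apply, mul_assoc]

theorem isMulBy_algebraMap {w : Weight} {σ₀ : ℝ} (hσ : IsAdmissible w σ₀) (c : ℂ) :
    IsMulBy σ₀ (algebraMap ℂ (H w →L[ℂ] H w) c) (algebraMap ℂ (Omega 0 →ᵇ ℂ) c) :=
  fun f _ hs => H.eval_smul hσ c f hs

end DirichletMult

theorem mainTheorem6 (μ : Measure ℝ≥0) [IsProbabilityMeasure μ] (hμ : 0 ∈ μ.support) :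
    IsAdmissible (measureWeight μ) (1 / 2) ∧
    ∀ (σ₀ : ℝ) (hσ : IsAdmissible (measureWeight μ) σ₀),
      (∀ φ : ℂ → ℂ, IsMultiplier (measureWeight μ) σ₀ φ →
        ∃ T ∈ multiplierAlgebra (measureWeight μ) σ₀ hσ,
          IsMulOperator (measureWeight μ) σ₀ φ T) ∧
      ∃ Φ : multiplierAlgebra (measureWeight μ) σ₀ hσ ≃ₐ[ℂ] hInfDirichlet,
        (∀ T : multiplierAlgebra (measureWeight μ) σ₀ hσ, ‖Φ T‖ = ‖T‖) ∧
        ∀ (T : multiplierAlgebra (measureWeight μ) σ₀ hσ) (f : H (measureWeight μ))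
          (s : Omega 0), (s : ℂ) ∈ Omega σ₀ →
            ((T : H (measureWeight μ) →L[ℂ]
                H (measureWeight μ)) f).eval s =
              (Φ T : Omega 0 →ᵇ ℂ) s * f.eval s := by
  refine ⟨isAdmissible_half μ hμ, fun σ₀ hσ => ⟨fun φ hφ => ?_, ?_⟩⟩
  · obtain ⟨T, hT⟩ := hφ.exists_isMulOperator hσ
    exact ⟨T, ⟨φ, hφ, hT⟩, hT⟩
  have h1 (T : multiplierAlgebra (measureWeight μ) σ₀ hσ) :
      ∃ ψ : hInfDirichlet, ‖ψ‖ ≤ ‖T‖ ∧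
        IsMulBy σ₀ (T : H (measureWeight μ) →L[ℂ] H (measureWeight μ)) ψ := by
    obtain ⟨T, φ, -, hT⟩ := T
    obtain ⟨ψ, hψ, hn, h⟩ := exists_mem_hInfDirichlet_of_isMulOperator μ hμ hσ hT
    exact ⟨⟨ψ, hψ⟩, hn, h⟩
  have h2 (ψ : hInfDirichlet) : ∃ T : multiplierAlgebra (measureWeight μ) σ₀ hσ, ‖T‖ ≤ ‖ψ‖ ∧
      IsMulBy σ₀ (T : H (measureWeight μ) →L[ℂ] H (measureWeight μ)) ψ := by
    obtain ⟨F, -, hFψ⟩ := ψ.2.1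
    obtain ⟨T, hn, h⟩ := exists_mulOperator_of_mem_hInfDirichlet μ hσ ψ.2
    have hT : IsMulOperator (measureWeight μ) σ₀ F T := fun f s hs => by
      rw [h f ⟨s, omega_subset hσ.1.le hs⟩ hs, ← hFψ]
    exact ⟨⟨T, F, fun f => ⟨T f, hT f⟩, hT⟩, hn, h⟩
  choose Ψ hΨn hΨ using h1
  choose Θ hΘn hΘ using h2
  have hΨΘ (ψ : hInfDirichlet) : Ψ (Θ ψ) = ψ := (hΨ _).symbol_ext hσ (hΘ ψ)
  have hΘΨ (T : multiplierAlgebra (measureWeight μ) σ₀ hσ) : Θ (Ψ T) = T :=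
    Subtype.ext ((hΘ _).operator_ext hσ (hΨ T))
  let Φ : multiplierAlgebra (measureWeight μ) σ₀ hσ ≃ₐ[ℂ] hInfDirichlet :=
    { toFun := Ψ
      invFun := Θ
      left_inv := hΘΨ
      right_inv := hΨΘ
      map_mul' S T := (hΨ (S * T)).symbol_ext hσ ((hΨ S).mul (hΨ T))
      map_add' S T := (hΨ (S + T)).symbol_ext hσ ((hΨ S).add hσ (hΨ T))
      commutes' c := (hΨ _).symbol_ext hσ (isMulBy_algebraMap hσ c) }
  -- Both Ψ and its inverse Θ are contractive, so Ψ is isometric.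
  refine ⟨Φ, fun T => le_antisymm (hΨn T) ?_, hΨ⟩
  have h3 := hΘn (Ψ T)
  rwa [hΘΨ] at h3
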